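/- An instance of the basic path-matching problem is a tuple $G=(T_1,T_2,S,E,\mathbf M_1,\mathbf M_2)$, where $T_1,T_2,S$ are pairwise disjoint finite sets, $(T_1\cup T_2\cup S,E)$ is a simple graph in which $T_1$ and $T_2$ are stable sets, and $\mathbf M_i$ is a matroid with ground set $T_i$ ($i=1,2$). For an edge set $N$ let $\partial_iN\subseteq T_i$ and $\partial_SN\subseteq S$ be the sets of vertices of $T_i$ and of $S$ that are covered by $N$. A path-matching is the edge set of a collection of node-disjoint paths, each with one endpoint in $T_1$, the other in $T_2$, and all inner vertices in $S$, together with a matching on the vertices of $S$ not contained in any of the paths. A basic path-matching (bpm) of $G$ is a path-matching $N$ such that $\partial_iN$ is a basis of $\mathbf M_i$ for $i=1,2$ and $\partial_SN=S$. Contraction. For $M\subseteq E$ put $\overline{\partial_iM}=T_i\setminus\partial_iM$ and $S'=S\setminus\partial_SM$. Let $C_i\subseteq S$ be the set of endpoints in $S$ of those paths of $M$ that have one endpoint in $T_i$ and the other in $S$; here the paths of $M$ are the connected components of the graph formed by the edges of $M$ that are paths. Let $T_i'=\overline{\partial_iM}\cup C_i$, let $E'\subseteq E$ be the set of edges with both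 endpoints in $S'$ or with one endpoint in $T_i'$ and the other in $S'\cup T_j'$, $i\ne j$, and let $\mathbf M_i'=(\mathbf M_i/\partial_iM)\oplus\mathbf F(C_i)$, where $\mathbf F(C_i)$ is the free matroid on $C_i$. The contraction of $G$ by $M$ is $G(M)=(T_1',T_2',S',E',\mathbf M_1',\mathbf M_2')$. The matrix $Z(M)$. Suppose $|T_1|=|T_2|=t$ and that $\mathbf M_1$ and $\mathbf M_2$ have the same rank $r$ and are linear over a common field $\mathbb F$: the columns of the $r\times t$ matrix $Q_1$ over $\mathbb F$ represent $\mathbf M_1$, and the rows of the $t\times r$ matrix $Q_2$ over $\mathbb F$ represent $\mathbf M_2$. Write $Q_1^J$ for the submatrix of $Q_1$ with columns $J$ and $Q_2^J$ for the submatrix of $Q_2$ with rows $J$. Let $X$ be the matrix with rows indexed by $T_1\cup S$ and columns indexed by $T_2\cup S$ whose entry $X_{i,j}$ is $\pm x_{\{i,j\}}$ if $\{i,j\}\in E$ and $0$ otherwise, where the $x_e$ ($e\in E$) are distinct indeterminates and the signs are chosen, otherwise arbitrarily, such that $X[S,S]$ is skew-symmetric. Let $D_i$ be the diagonal matrix with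 rows and columns indexed by $\overline{\partial_iM}$ whose diagonal entries are indeterminates, all of them (over $i=1,2$) distinct from each other and from the $x_e$. Define $$Z(M)=\begin{pmatrix} 0 & Q_1^{\partial_1M} & Q_1^{\overline{\partial_1M}} & 0 & 0\\ Q_2^{\partial_2M} & 0 & 0 & 0 & 0\\ Q_2^{\overline{\partial_2M}} & 0 & 0 & D_2 & 0\\ 0 & 0 & D_1 & X[\overline{\partial_1M},\overline{\partial_2M}] & X[\overline{\partial_1M},C_2\cup S']\\ 0 & 0 & 0 & X[C_1\cup S',\overline{\partial_2M}] & X[C_1\cup S',C_2\cup S'] \end{pmatrix},$$ a matrix over the polynomial ring over $\mathbb F$ in all these indeterminates. It is called non-singular if it is square and its determinant is not the zero polynomial. Theorem. Let $M\subseteq E$ be a set of edges such that $\partial_1M$ is independent in $\mathbf M_1$ and $\partial_2M$ is independent in $\mathbf M_2$. Then $G(M)$ has a basic path-matching if and only if $Z(M)$ is non-singular. -/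

import Mathlib

/-- The data `(T₁, T₂, S, E, 𝐌₁, 𝐌₂)` of a basic path-matching problem: a finite graph whose vertex
set is the disjoint union of `T₁`, `T₂`, `S`, with `T₁` and `T₂` stable, and a matroid on each `Tᵢ`.
The vertices are taken from an ambient type `V`; vertices of `V` outside `T₁ ∪ T₂ ∪ S` are isolated
in `graph` and play no role. (That `T₁`, `T₂` have equal size and `𝐌₁`, `𝐌₂` equal rank is stated
separately, as it may fail for a contraction by an arbitrary edge set.) -/
structure PathMatchingInstance (V : Type*) [DecidableEq V] where
  T₁ : Finset V
  T₂ : Finset V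
  S : Finset V
  graph : SimpleGraph V
  M₁ : Matroid V
  M₂ : Matroid V
  disj_T₁_T₂ : Disjoint T₁ T₂
  disj_T₁_S : Disjoint T₁ S
  disj_T₂_S : Disjoint T₂ S
  mem_of_adj : ∀ u v, graph.Adj u v → u ∈ T₁ ∪ T₂ ∪ S
  stable₁ : ∀ u ∈ T₁, ∀ v ∈ T₁, ¬ graph.Adj u v
  stable₂ : ∀ u ∈ T₂, ∀ v ∈ T₂, ¬ graph.Adj u v
  ground₁ : M₁.E = (T₁ : Set V)
  ground₂ : M₂.E = (T₂ : Set V)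

/-- The vertices of `A` that are covered by the edge set `M`. -/
noncomputable def coveredIn {V : Type*} (A : Finset V) (M : Set (Sym2 V)) : Finset V :=
  open Classical in A.filter (fun v => ∃ e ∈ M, v ∈ e)

theorem mem_coveredIn {V : Type*} {A : Finset V} {M : Set (Sym2 V)} {v : V} :
    v ∈ coveredIn A M ↔ v ∈ A ∧ ∃ e ∈ M, v ∈ e := by
  simp [coveredIn]

theorem coveredIn_subset {V : Type*} (A : Finset V) (M : Set (Sym2 V)) : coveredIn A M ⊆ A :=
  fun _ h => (mem_coveredIn.1 h).1

/-- `p` is a path that forms a whole component of the edge set `M`: its edges lie in `M`, and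
every edge of `M` that meets `p` is an edge of `p`. -/
def IsPathComponent {V : Type*} {H : SimpleGraph V} {u v : V} (p : H.Walk u v)
    (M : Set (Sym2 V)) : Prop :=
  p.IsPath ∧ (∀ e ∈ p.edges, e ∈ M) ∧ ∀ e ∈ M, ∀ w ∈ e, w ∈ p.support → e ∈ p.edges

/-- Two paths that are components of the same edge set and end in the same vertex, both
non-trivial, start in the same vertex. -/
theorem IsPathComponent.start_eq {V : Type*} {H : SimpleGraph V} {u v s : V}
    {p : H.Walk u s} {q : H.Walk v s} {M : Set (Sym2 V)} (hp : IsPathComponent p M)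
    (hq : IsPathComponent q M) (hvs : v ≠ s) : v = u := by
  classical
  by_contra hvu
  -- every vertex of `q` lies on `p`
  have key : ∀ {a b : V} (w : H.Walk a b), (∀ e ∈ w.edges, e ∈ M) → b ∈ p.support →
      a ∈ p.support := by
    intro a b w
    induction w with
    | nil => exact fun _ h => h
    | cons h w ih =>
      intro hw hb
      have hc := ih (fun e he => hw e (by simp [he])) hb
      have he := hp.2.2 _ (hw s(_, _) (List.mem_cons_self ..)) _
        (Sym2.mem_mk_right _ _) hc
      exact p.fst_mem_support_of_mem_edges he
  have hv : v ∈ p.support := key q hq.2.1 p.end_mem_support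
  -- `v` lies on exactly one edge of `q`, hence of `M`
  have huniq : ∀ e ∈ M, ∀ e' ∈ M, v ∈ e → v ∈ e' → e = e' := by
    have hM : ∀ e ∈ M, v ∈ e → e ∈ q.edges := fun e he hve =>
      hq.2.2 e he v hve q.start_mem_support
    have hq1 := hq.1
    intro e he e' he' hve hve'
    have h1 := hM e he hve
    have h2 := hM e' he' hve'
    clear hM key hq
    cases q with
    | nil => exact absurd rfl hvs
    | cons h q' =>
      rw [SimpleGraph.Walk.cons_isPath_iff] at hq1
      have hno : ∀ f ∈ q'.edges, v ∉ f := fun f hf hvf =>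
        hq1.2 (SimpleGraph.Walk.mem_support_of_mem_edges hf hvf)
      rw [SimpleGraph.Walk.edges_cons, List.mem_cons] at h1 h2
      rcases h1 with h1 | h1
      · rcases h2 with h2 | h2
        · rw [h1, h2]
        · exact absurd hve' (hno _ h2)
      · exact absurd hve (hno _ h1)
  -- but `v` is an inner vertex of `p`, so it lies on two edges of `p`
  have hedges : (p.takeUntil v hv).edges ++ (p.dropUntil v hv).edges = p.edges := by
    rw [← SimpleGraph.Walk.edges_append, SimpleGraph.Walk.take_spec]
  have hnodup : p.edges.Nodup := hp.1.isTrail.edges_nodup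
  have hend : ∀ {a : V} (w : H.Walk v a), v ≠ a → ∃ e ∈ w.edges, v ∈ e := by
    intro a w hva
    cases w with
    | nil => exact absurd rfl hva
    | cons h w => exact ⟨s(_, _), List.mem_cons_self .., Sym2.mem_mk_left _ _⟩
  obtain ⟨e, he, hve⟩ := hend (p.takeUntil v hv).reverse hvu
  obtain ⟨e', he', hve'⟩ := hend (p.dropUntil v hv) hvs
  rw [SimpleGraph.Walk.edges_reverse, List.mem_reverse] at he
  have heq : e = e' := huniq e (hp.2.1 e (by rw [← hedges]; simp [he])) e'
    (hp.2.1 e' (by rw [← hedges]; simp [he'])) hve hve'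
  rw [← hedges, List.nodup_append] at hnodup
  exact hnodup.2.2 e he e' he' heq

theorem IsPathComponent.end_covered {V : Type*} {H : SimpleGraph V} {u s : V}
    {p : H.Walk u s} {M : Set (Sym2 V)} (hp : IsPathComponent p M) (hus : u ≠ s) :
    ∃ e ∈ M, s ∈ e := by
  have h : ∃ e ∈ p.reverse.edges, s ∈ e := by
    cases p.reverse with
    | nil => exact absurd rfl hus
    | cons h w => exact ⟨s(_, _), List.mem_cons_self .., Sym2.mem_mk_left _ _⟩
  obtain ⟨e, he, hs⟩ := h
  exact ⟨e, hp.2.1 e (by simpa using he), hs⟩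

namespace PathMatchingInstance

variable {V : Type*} [DecidableEq V]

/-- `M` is a path-matching: the edge set of a collection `p` of node-disjoint paths in the graph,
each with one endpoint in `T₁`, the other in `T₂` and all inner vertices in `S`, together with a
matching `N` on the vertices of `S` that are on none of the paths. -/
def IsPathMatching (G : PathMatchingInstance V) (M : Set (Sym2 V)) : Prop :=
  ∃ (k : ℕ) (a b : Fin k → V) (p : ∀ i, G.graph.Walk (a i) (b i)) (N : Set (Sym2 V)),
    (∀ i, (p i).IsPath ∧ a i ∈ G.T₁ ∧ b i ∈ G.T₂ ∧
      ∀ v ∈ (p i).support, v ≠ a i → v ≠ b i → v ∈ G.S) ∧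
    (∀ i j, i ≠ j → ∀ v ∈ (p i).support, v ∉ (p j).support) ∧
    N ⊆ G.graph.edgeSet ∧
    (∀ e ∈ N, ∀ v ∈ e, v ∈ G.S ∧ ∀ i, v ∉ (p i).support) ∧
    (∀ e ∈ N, ∀ e' ∈ N, ∀ v, v ∈ e → v ∈ e' → e = e') ∧
    M = {e | ∃ i, e ∈ (p i).edges} ∪ N

/-- `M` is a basic path-matching (bpm): a path-matching whose covered vertices form a basis of
`𝐌ᵢ` in `Tᵢ` and all of `S`. -/
def IsBasicPathMatching (G : PathMatchingInstance V) (M : Set (Sym2 V)) : Prop :=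
  G.IsPathMatching M ∧ G.M₁.IsBase (coveredIn G.T₁ M : Set V) ∧
    G.M₂.IsBase (coveredIn G.T₂ M : Set V) ∧ coveredIn G.S M = G.S

/-- `T₁ \ ∂₁M`, the vertices of `T₁` that are not covered. -/
noncomputable def exposed₁ (G : PathMatchingInstance V) (M : Set (Sym2 V)) : Finset V :=
  G.T₁ \ coveredIn G.T₁ M

/-- `T₂ \ ∂₂M`, the vertices of `T₂` that are not covered. -/
noncomputable def exposed₂ (G : PathMatchingInstance V) (M : Set (Sym2 V)) : Finset V :=
  G.T₂ \ coveredIn G.T₂ M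

/-- `S' = S \ ∂_S M`. -/
noncomputable def exposedS (G : PathMatchingInstance V) (M : Set (Sym2 V)) : Finset V :=
  G.S \ coveredIn G.S M

/-- The endpoints in `S` of those paths of `M` that have one endpoint in `T` and the other in `S`;
the paths of `M` are the components of `M` that are paths. -/
noncomputable def pathEnds (G : PathMatchingInstance V) (T : Finset V) (M : Set (Sym2 V)) :
    Finset V :=
  open Classical in
    G.S.filter (fun s => ∃ u ∈ T, ∃ p : G.graph.Walk u s, IsPathComponent p M)

/-- `C₁`. -/
noncomputable def C₁ (G : PathMatchingInstance V) (M : Set (Sym2 V)) : Finset V :=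
  G.pathEnds G.T₁ M

/-- `C₂`. -/
noncomputable def C₂ (G : PathMatchingInstance V) (M : Set (Sym2 V)) : Finset V :=
  G.pathEnds G.T₂ M

/-- `T₁' = (T₁ \ ∂₁M) ∪ C₁`. -/
noncomputable def T₁' (G : PathMatchingInstance V) (M : Set (Sym2 V)) : Finset V :=
  G.exposed₁ M ∪ G.C₁ M

/-- `T₂' = (T₂ \ ∂₂M) ∪ C₂`. -/
noncomputable def T₂' (G : PathMatchingInstance V) (M : Set (Sym2 V)) : Finset V :=
  G.exposed₂ M ∪ G.C₂ M

/-- The graph with edge set `E'`: the edges of `G` with both endpoints in `S'`, or with one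
endpoint in `Tᵢ'` and the other in `S' ∪ Tⱼ'`, `i ≠ j`. -/
def contractGraph (G : PathMatchingInstance V) (M : Set (Sym2 V)) : SimpleGraph V where
  Adj u v := G.graph.Adj u v ∧
    ((u ∈ G.exposedS M ∧ v ∈ G.exposedS M) ∨
      (u ∈ G.T₁' M ∧ v ∈ G.exposedS M ∪ G.T₂' M) ∨ (v ∈ G.T₁' M ∧ u ∈ G.exposedS M ∪ G.T₂' M) ∨
      (u ∈ G.T₂' M ∧ v ∈ G.exposedS M ∪ G.T₁' M) ∨ (v ∈ G.T₂' M ∧ u ∈ G.exposedS M ∪ G.T₁' M))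
  symm := ⟨fun u v h => ⟨h.1.symm, by tauto⟩⟩
  loopless := ⟨fun u h => G.graph.loopless.irrefl u h.1⟩

theorem mem_pathEnds (G : PathMatchingInstance V) {T : Finset V} {M : Set (Sym2 V)} {s : V} :
    s ∈ G.pathEnds T M ↔
      s ∈ G.S ∧ ∃ u ∈ T, ∃ p : G.graph.Walk u s, IsPathComponent p M := by
  simp [pathEnds]

theorem pathEnds_subset (G : PathMatchingInstance V) (T : Finset V) (M : Set (Sym2 V)) :
    G.pathEnds T M ⊆ G.S :=
  fun _ h => (G.mem_pathEnds.1 h).1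

theorem exposed₁_disjoint_C₁ (G : PathMatchingInstance V) (M : Set (Sym2 V)) :
    Disjoint (G.exposed₁ M) (G.C₁ M) :=
  G.disj_T₁_S.mono Finset.sdiff_subset (G.pathEnds_subset _ _)

theorem exposed₂_disjoint_C₂ (G : PathMatchingInstance V) (M : Set (Sym2 V)) :
    Disjoint (G.exposed₂ M) (G.C₂ M) :=
  G.disj_T₂_S.mono Finset.sdiff_subset (G.pathEnds_subset _ _)

theorem C₁_disjoint_C₂ (G : PathMatchingInstance V) (M : Set (Sym2 V)) :
    Disjoint (G.C₁ M) (G.C₂ M) := by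
  rw [Finset.disjoint_left]
  intro s h₁ h₂
  obtain ⟨hs, u, hu, p, hp⟩ := G.mem_pathEnds.1 h₁
  obtain ⟨-, v, hv, q, hq⟩ := G.mem_pathEnds.1 h₂
  have hvs : v ≠ s := fun h => Finset.disjoint_left.1 G.disj_T₂_S hv (h ▸ hs)
  exact Finset.disjoint_left.1 G.disj_T₁_T₂ hu (hp.start_eq hq hvs ▸ hv)

theorem pathEnds_disjoint_exposedS (G : PathMatchingInstance V) {T : Finset V}
    (hT : Disjoint T G.S) (M : Set (Sym2 V)) : Disjoint (G.pathEnds T M) (G.exposedS M) := by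
  rw [Finset.disjoint_left]
  intro s h₁ h₂
  obtain ⟨hs, u, hu, p, hp⟩ := G.mem_pathEnds.1 h₁
  have hus : u ≠ s := fun h => Finset.disjoint_left.1 hT hu (h ▸ hs)
  exact (Finset.mem_sdiff.1 h₂).2 (mem_coveredIn.2 ⟨hs, hp.end_covered hus⟩)

theorem disjoint_T₁'_T₂' (G : PathMatchingInstance V) (M : Set (Sym2 V)) :
    Disjoint (G.T₁' M) (G.T₂' M) := by
  rw [T₁', T₂', Finset.disjoint_union_left, Finset.disjoint_union_right,
    Finset.disjoint_union_right]
  exact ⟨⟨G.disj_T₁_T₂.mono Finset.sdiff_subset Finset.sdiff_subset,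
    G.disj_T₁_S.mono Finset.sdiff_subset (G.pathEnds_subset _ _)⟩,
    (G.disj_T₂_S.mono Finset.sdiff_subset (G.pathEnds_subset _ _)).symm, G.C₁_disjoint_C₂ M⟩

theorem disjoint_T₁'_exposedS (G : PathMatchingInstance V) (M : Set (Sym2 V)) :
    Disjoint (G.T₁' M) (G.exposedS M) := by
  rw [T₁', Finset.disjoint_union_left]
  exact ⟨G.disj_T₁_S.mono Finset.sdiff_subset Finset.sdiff_subset,
    G.pathEnds_disjoint_exposedS G.disj_T₁_S M⟩

theorem disjoint_T₂'_exposedS (G : PathMatchingInstance V) (M : Set (Sym2 V)) :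
    Disjoint (G.T₂' M) (G.exposedS M) := by
  rw [T₂', Finset.disjoint_union_left]
  exact ⟨G.disj_T₂_S.mono Finset.sdiff_subset Finset.sdiff_subset,
    G.pathEnds_disjoint_exposedS G.disj_T₂_S M⟩

theorem disjoint_ground₁ (G : PathMatchingInstance V) (M : Set (Sym2 V)) :
    Disjoint (G.M₁.contract (coveredIn G.T₁ M : Set V)).E
      (Matroid.freeOn (G.C₁ M : Set V)).E := by
  rw [Matroid.contract_ground, Matroid.freeOn_ground, G.ground₁, ← Finset.coe_sdiff]
  exact_mod_cast G.exposed₁_disjoint_C₁ M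

theorem disjoint_ground₂ (G : PathMatchingInstance V) (M : Set (Sym2 V)) :
    Disjoint (G.M₂.contract (coveredIn G.T₂ M : Set V)).E
      (Matroid.freeOn (G.C₂ M : Set V)).E := by
  rw [Matroid.contract_ground, Matroid.freeOn_ground, G.ground₂, ← Finset.coe_sdiff]
  exact_mod_cast G.exposed₂_disjoint_C₂ M

/-- The contraction `G(M) = (T₁', T₂', S', E', 𝐌₁', 𝐌₂')` with
`𝐌ᵢ' = (𝐌ᵢ / ∂ᵢM) ⊕ F(Cᵢ)`. -/
noncomputable def contract (G : PathMatchingInstance V) (M : Set (Sym2 V)) :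
    PathMatchingInstance V where
  T₁ := G.T₁' M
  T₂ := G.T₂' M
  S := G.exposedS M
  graph := G.contractGraph M
  M₁ := Matroid.disjointSum (G.M₁.contract (coveredIn G.T₁ M : Set V))
    (Matroid.freeOn (G.C₁ M : Set V)) (G.disjoint_ground₁ M)
  M₂ := Matroid.disjointSum (G.M₂.contract (coveredIn G.T₂ M : Set V))
    (Matroid.freeOn (G.C₂ M : Set V)) (G.disjoint_ground₂ M)
  disj_T₁_T₂ := G.disjoint_T₁'_T₂' M
  disj_T₁_S := G.disjoint_T₁'_exposedS M
  disj_T₂_S := G.disjoint_T₂'_exposedS M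
  mem_of_adj u v h := by
    have h' := h.2
    simp only [Finset.mem_union] at h' ⊢
    tauto
  stable₁ u hu v hv h := by
    have h₁ := Finset.disjoint_left.1 (G.disjoint_T₁'_T₂' M)
    have h₂ := Finset.disjoint_left.1 (G.disjoint_T₁'_exposedS M)
    have h' := h.2
    have := h₁ hu
    have := h₁ hv
    have := h₂ hu
    have := h₂ hv
    simp only [Finset.mem_union] at h'
    tauto
  stable₂ u hu v hv h := by
    have h₁ := Finset.disjoint_right.1 (G.disjoint_T₁'_T₂' M)
    have h₂ := Finset.disjoint_left.1 (G.disjoint_T₂'_exposedS M)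
    have h' := h.2
    have := h₁ hu
    have := h₁ hv
    have := h₂ hu
    have := h₂ hv
    simp only [Finset.mem_union] at h'
    tauto
  ground₁ := by
    rw [Matroid.disjointSum_ground_eq, Matroid.contract_ground, Matroid.freeOn_ground, G.ground₁,
      T₁', exposed₁, Finset.coe_union, Finset.coe_sdiff]
  ground₂ := by
    rw [Matroid.disjointSum_ground_eq, Matroid.contract_ground, Matroid.freeOn_ground, G.ground₂,
      T₂', exposed₂, Finset.coe_union, Finset.coe_sdiff]

end PathMatchingInstance

/-- The vectors `w v`, `v ∈ T`, represent the matroid `M` (with ground set `T`) over `F`: a subset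
of `T` is independent in `M` iff the corresponding vectors are linearly independent. -/
def RepresentsMatroid {V F W : Type*} [Field F] [AddCommGroup W] [Module F W] {T : Finset V}
    (w : T → W) (M : Matroid V) : Prop :=
  M.E = (T : Set V) ∧
    ∀ I : Set T, M.Indep (Subtype.val '' I) ↔ LinearIndepOn F w I

/-- The indeterminates: one `x_e` for every unordered pair `e` of vertices, and the diagonal
entries of `D₁` and `D₂`. All of them are distinct. -/
inductive Indet (V : Type*)
  | x (e : Sym2 V)
  | d₁ (v : V)
  | d₂ (v : V)

/-- A matrix of polynomials, whose rows and columns may be indexed by different types, is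
non-singular if it is square (there are as many rows as columns) and its determinant, which is
well defined up to sign, is not the zero polynomial. -/
def Matrix.IsNonsingular {m n R : Type*} [Fintype m] [DecidableEq m] [CommRing R]
    (A : Matrix m n R) : Prop :=
  ∃ e : m ≃ n, (A.submatrix id e).det ≠ 0

namespace PathMatchingInstance

variable {V : Type*} [DecidableEq V]

/-- The matrix `X` of the graph with signs `ε`: the entry at `(i, j)` is `ε i j * x_{ij}` if
`{i, j}` is an edge and `0` otherwise. Only rows in `T₁ ∪ S` and columns in `T₂ ∪ S` are used. -/
noncomputable def edgeMatrix (G : PathMatchingInstance V) (F : Type*) [Field F]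
    (ε : V → V → ℤˣ) : Matrix V V (MvPolynomial (Indet V) F) :=
  open Classical in
    Matrix.of fun i j =>
      if G.graph.Adj i j then ((ε i j : ℤ) : MvPolynomial (Indet V) F) *
        MvPolynomial.X (Indet.x s(i, j)) else 0

/-- The rows of `Z(M)`: the `r` rows of `Q₁`, then `∂₂M`, `T₂ \ ∂₂M`, `T₁ \ ∂₁M`, `C₁ ∪ S'`. -/
abbrev ZRow (G : PathMatchingInstance V) (r : ℕ) (M : Set (Sym2 V)) : Type _ :=
  Fin r ⊕ coveredIn G.T₂ M ⊕ G.exposed₂ M ⊕ G.exposed₁ M ⊕ (G.C₁ M ∪ G.exposedS M : Finset V)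

/-- The columns of `Z(M)`: the `r` columns of `Q₂`, then `∂₁M`, `T₁ \ ∂₁M`, `T₂ \ ∂₂M`,
`C₂ ∪ S'`. -/
abbrev ZCol (G : PathMatchingInstance V) (r : ℕ) (M : Set (Sym2 V)) : Type _ :=
  Fin r ⊕ coveredIn G.T₁ M ⊕ G.exposed₁ M ⊕ G.exposed₂ M ⊕ (G.C₂ M ∪ G.exposedS M : Finset V)

/-- The matrix `Z(M)`, block by block; `D₁` and `D₂` are diagonal with distinct indeterminates. -/
noncomputable def Z (G : PathMatchingInstance V) {F : Type*} [Field F] {r : ℕ}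
    (Q₁ : Matrix (Fin r) G.T₁ F) (Q₂ : Matrix G.T₂ (Fin r) F) (ε : V → V → ℤˣ)
    (M : Set (Sym2 V)) : Matrix (G.ZRow r M) (G.ZCol r M) (MvPolynomial (Indet V) F) :=
  Matrix.of fun i j =>
    match i, j with
    | .inl a, .inr (.inl v) => MvPolynomial.C (Q₁ a ⟨v, coveredIn_subset _ _ v.2⟩)
    | .inl a, .inr (.inr (.inl v)) => MvPolynomial.C (Q₁ a ⟨v, Finset.sdiff_subset v.2⟩)
    | .inr (.inl u), .inl b => MvPolynomial.C (Q₂ ⟨u, coveredIn_subset _ _ u.2⟩ b)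
    | .inr (.inr (.inl u)), .inl b => MvPolynomial.C (Q₂ ⟨u, Finset.sdiff_subset u.2⟩ b)
    | .inr (.inr (.inl u)), .inr (.inr (.inr (.inl v))) =>
        Matrix.diagonal (fun w : G.exposed₂ M => MvPolynomial.X (Indet.d₂ w.1)) u v
    | .inr (.inr (.inr (.inl u))), .inr (.inr (.inl v)) =>
        Matrix.diagonal (fun w : G.exposed₁ M => MvPolynomial.X (Indet.d₁ w.1)) u v
    | .inr (.inr (.inr (.inl u))), .inr (.inr (.inr (.inl v))) => G.edgeMatrix F ε u v
    | .inr (.inr (.inr (.inl u))), .inr (.inr (.inr (.inr v))) => G.edgeMatrix F ε u v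
    | .inr (.inr (.inr (.inr u))), .inr (.inr (.inr (.inl v))) => G.edgeMatrix F ε u v
    | .inr (.inr (.inr (.inr u))), .inr (.inr (.inr (.inr v))) => G.edgeMatrix F ε u v
    | _, _ => 0

end PathMatchingInstance

/-! Expand `det Z(M)` multilinearly along the rows that meet `D₁` and the columns that meet `D₂`. A
choice is given by sets `A₁`, `A₂` of uncovered vertices of `T₁`, `T₂` at which the part in `X` is
taken instead of the diagonal entry. Up to sign and a monomial in the diagonal indeterminates, it
contributes the product of the determinants of `Q₁` on `∂₁M ∪ A₁`, of `Q₂` on `∂₂M ∪ A₂`, and of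
`X[A₁ ∪ C₁ ∪ S', A₂ ∪ C₂ ∪ S']`. The first two factors are nonzero exactly when `∂ᵢM ∪ Aᵢ` is a
basis of `𝐌ᵢ`, that is, when `Aᵢ ∪ Cᵢ` is a basis of `𝐌ᵢ'`. The third is nonzero exactly when some
path-matching of `G(M)` has these path ends and covers `S'`.

If `Z(M)` is non-singular, some choice survives (`exists_split_of_isNonsingular_blockMatrix`) and
its three factors are nonzero (`isBase_of_isNonsingular_blockMatrix`). A path-matching is then read
off from `X` (`TrivialKernelOn.exists_isLinkage`). Laplace expansion in the row of a path start `a`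
yields an edge `av`; either `v` is a path end, or `v` lies in `S'` and its row takes over as the new
start. With no starts left, a skew-symmetric block remains, and a Pfaffian-like expansion splits off
matching edges.

Conversely, a basic path-matching `N` dictates an evaluation of the indeterminates at which the
determinant is nonzero: the edges of `N` force a kernel vector of `X` to vanish vertex by vertex
(`IsPathMatching.trivialKernelOn`), and `isNonsingular_blockMatrix` assembles the blocks.
Throughout, non-singularity over a domain is used in the form "square with trivial kernel", which
avoids computing with determinants. -/

/-- The submatrix of `K` with rows `P` and columns `Q` is square with trivial kernel. -/
def TrivialKernelOn {V R : Type*} [CommRing R] (K : V → V → R) (P Q : Finset V) : Prop :=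
  P.card = Q.card ∧ ∀ y : V → R, (∀ j ∉ Q, y j = 0) → (∀ i ∈ P, ∑ j ∈ Q, K i j * y j = 0) → y = 0

/-! ### Laplace and Pfaffian expansions in terms of kernels. -/

section LinearAlgebra

variable {V R : Type*} [CommRing R]

theorem exists_kernel_vector_of_card_lt [Nontrivial R] (K : V → V → R) {P Q : Finset V}
    (h : P.card < Q.card) :
    ∃ y : V → R, y ≠ 0 ∧ (∀ j ∉ Q, y j = 0) ∧ ∀ i ∈ P, ∑ j ∈ Q, K i j * y j = 0 := by
  classical
  let f : (Q → R) →ₗ[R] (P → R) := Matrix.mulVecLin (Matrix.of fun i j => K i j)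
  have hf : ¬ Function.Injective f := fun hinj => by
    have := LinearMap.finrank_le_finrank_of_injective hinj
    simp at this
    omega
  rw [injective_iff_map_eq_zero] at hf
  push Not at hf
  obtain ⟨c, hc, hc0⟩ := hf
  refine ⟨fun v => if h : v ∈ Q then c ⟨v, h⟩ else 0, fun h0 => hc0 ?_, fun j hj => by simp [hj],
    fun i hi => ?_⟩
  · ext j
    simpa using congrFun h0 j
  · have := congrFun hc ⟨i, hi⟩
    rw [← Finset.sum_coe_sort]
    simpa [f, Matrix.mulVec, dotProduct] using this

variable {K : V → V → R} {P Q : Finset V}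

/-- The bilinear form of a skew-symmetric matrix is skew-symmetric. -/
theorem sum_mul_sum_eq_neg {S : Finset V} (hskew : ∀ i ∈ S, ∀ j ∈ S, K j i = - K i j)
    (y z : V → R) :
    ∑ i ∈ S, y i * ∑ j ∈ S, K i j * z j = - ∑ i ∈ S, z i * ∑ j ∈ S, K i j * y j := by
  simp only [Finset.mul_sum]
  rw [Finset.sum_comm, ← Finset.sum_neg_distrib]
  refine Finset.sum_congr rfl fun i hi => ?_
  rw [← Finset.sum_neg_distrib]
  refine Finset.sum_congr rfl fun j hj => ?_
  rw [hskew i hi j hj]; ring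

/-- The terms at `(i, j)` and `(j, i)` cancel. The zero diagonal is a separate hypothesis because in
characteristic 2 it does not follow from skew-symmetry. -/
theorem sum_mul_sum_self {S : Finset V} (hskew : ∀ i ∈ S, ∀ j ∈ S, K j i = - K i j)
    (hdiag : ∀ i, K i i = 0) (y : V → R) : ∑ i ∈ S, y i * ∑ j ∈ S, K i j * y j = 0 := by
  simp only [Finset.mul_sum]
  rw [← Finset.sum_product']
  refine Finset.sum_involution (fun x _ => x.swap) ?_ ?_ ?_ ?_
  · rintro ⟨i, j⟩ hij
    rw [Finset.mem_product] at hij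
    simp only [Prod.swap_prod_mk]
    rw [hskew i hij.1 j hij.2]; ring
  · rintro ⟨i, j⟩ - hij heq
    obtain rfl : j = i := congrArg Prod.fst heq
    simp [hdiag] at hij
  · rintro ⟨i, j⟩ hij
    rw [Finset.mem_product] at hij ⊢
    exact ⟨hij.2, hij.1⟩
  · simp

variable [DecidableEq V]

/-- Without row `a` there are fewer rows than columns, so a nonzero kernel vector exists; if row `a`
killed it too, it would be zero. It plays the role of the vector of cofactors of row `a`. -/
theorem TrivialKernelOn.exists_kernel_erase [Nontrivial R] (h : TrivialKernelOn K P Q) {a : V}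
    (ha : a ∈ P) :
    ∃ y : V → R, (∀ j ∉ Q, y j = 0) ∧ (∀ i ∈ P, i ≠ a → ∑ j ∈ Q, K i j * y j = 0) ∧
      ∑ j ∈ Q, K a j * y j ≠ 0 := by
  have hcard : (P.erase a).card < Q.card := by
    rw [← h.1]; exact Finset.card_erase_lt_of_mem ha
  obtain ⟨y, hy0, hyQ, hy⟩ := exists_kernel_vector_of_card_lt K hcard
  refine ⟨y, hyQ, fun i hi hia => hy i (Finset.mem_erase.2 ⟨hia, hi⟩), fun hya => hy0 ?_⟩
  refine h.2 y hyQ fun i hi => ?_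
  by_cases hia : i = a
  · rw [hia, hya]
  · exact hy i (Finset.mem_erase.2 ⟨hia, hi⟩)

/-- With row `a` removed the kernel has rank one, so a vector in it is determined by its entry at
`v`. The combination of `y` and `z` that row `a` kills is formed by cross-multiplication, as a
domain has no division. -/
theorem TrivialKernelOn.eq_zero_of_erase [IsDomain R] (h : TrivialKernelOn K P Q) {a v : V}
    {y : V → R} (hyQ : ∀ j ∉ Q, y j = 0)
    (hy : ∀ i ∈ P, i ≠ a → ∑ j ∈ Q, K i j * y j = 0) (hya : ∑ j ∈ Q, K a j * y j ≠ 0)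
    (hyv : y v ≠ 0) {z : V → R} (hzQ : ∀ j ∉ Q, z j = 0) (hzv : z v = 0)
    (hz : ∀ i ∈ P, i ≠ a → ∑ j ∈ Q, K i j * z j = 0) : z = 0 := by
  have hcomb (i : V) : ∑ j ∈ Q, K i j * ((∑ j ∈ Q, K a j * z j) * y j
      - (∑ j ∈ Q, K a j * y j) * z j) = (∑ j ∈ Q, K a j * z j) * (∑ j ∈ Q, K i j * y j)
      - (∑ j ∈ Q, K a j * y j) * (∑ j ∈ Q, K i j * z j) := by
    rw [Finset.mul_sum (a := ∑ j ∈ Q, K a j * z j), Finset.mul_sum (a := ∑ j ∈ Q, K a j * y j),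
      ← Finset.sum_sub_distrib]
    exact Finset.sum_congr rfl fun j _ => by ring
  have h0 := h.2 (fun j => (∑ j ∈ Q, K a j * z j) * y j - (∑ j ∈ Q, K a j * y j) * z j)
    (fun j hj => by simp [hyQ j hj, hzQ j hj]) (fun i hi => by
      rw [hcomb]
      by_cases hia : i = a
      · subst hia; ring
      · rw [hy i hi hia, hz i hi hia]; ring)
  have hza : ∑ j ∈ Q, K a j * z j = 0 := by
    have := congrFun h0 v
    simpa [hzv, hyv] using this
  ext j
  have := congrFun h0 j
  simpa [hza, hya] using this

/-- This replaces Laplace expansion along row `a`: some term `K a v * y v` is nonzero, so both the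
entry and the complementary minor are. -/
theorem TrivialKernelOn.exists_erase [IsDomain R] (h : TrivialKernelOn K P Q) {a : V}
    (ha : a ∈ P) : ∃ v ∈ Q, K a v ≠ 0 ∧ TrivialKernelOn K (P.erase a) (Q.erase v) := by
  obtain ⟨y, hyQ, hy, hya⟩ := h.exists_kernel_erase ha
  obtain ⟨v, hv, hv0⟩ := Finset.exists_ne_zero_of_sum_ne_zero hya
  refine ⟨v, hv, left_ne_zero_of_mul hv0, ?_, fun z hzQ hz => ?_⟩
  · rw [Finset.card_erase_of_mem ha, Finset.card_erase_of_mem hv, h.1]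
  · have hzv : z v = 0 := hzQ v (Finset.notMem_erase v Q)
    refine h.eq_zero_of_erase hyQ hy hya (right_ne_zero_of_mul hv0)
      (fun j hj => hzQ j fun h => hj (Finset.mem_of_mem_erase h)) hzv fun i hi hia => ?_
    rw [← hz i (Finset.mem_erase.2 ⟨hia, hi⟩), Finset.sum_erase]
    rw [hzv, mul_zero]

/-- This is the analogue of expanding a Pfaffian along row `s`: rows and columns are deleted in
pairs, so the remaining matrix is again skew-symmetric. -/
theorem TrivialKernelOn.exists_erase_erase [IsDomain R] {S : Finset V}
    (h : TrivialKernelOn K S S) (hskew : ∀ i ∈ S, ∀ j ∈ S, K j i = - K i j)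
    (hdiag : ∀ i, K i i = 0) {s : V} (hs : s ∈ S) :
    ∃ v ∈ S, v ≠ s ∧ K s v ≠ 0 ∧
      TrivialKernelOn K ((S.erase s).erase v) ((S.erase s).erase v) := by
  obtain ⟨y, hyS, hy, hys⟩ := h.exists_kernel_erase hs
  obtain ⟨v, hv, hv0⟩ := Finset.exists_ne_zero_of_sum_ne_zero hys
  have hKv := left_ne_zero_of_mul hv0
  have hyv := right_ne_zero_of_mul hv0
  have hvs : v ≠ s := by rintro rfl; exact hKv (hdiag v)
  refine ⟨v, hv, hvs, hKv, rfl, fun z hzS hz => ?_⟩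
  have hzs : z s = 0 := hzS s (by simp)
  have hzv : z v = 0 := hzS v (by simp)
  have hzS' : ∀ j ∉ S, z j = 0 := fun j hj => hzS j (by simp [hj])
  have hz' : ∀ i ∈ S, i ≠ s → i ≠ v → ∑ j ∈ S, K i j * z j = 0 := fun i hi his hiv => by
    rw [← hz i (by simp [hi, his, hiv]), Finset.sum_erase _ (by simp [hzv]),
      Finset.sum_erase _ (by simp [hzs])]
  -- In the form `yᵀKy = 0` only the term at `s` survives, and row `s` does not kill `y`.
  have hys0 : y s = 0 := by
    have h0 := sum_mul_sum_self hskew hdiag y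
    rw [Finset.sum_eq_single_of_mem s hs fun i hi his => by rw [hy i hi his, mul_zero]] at h0
    exact (mul_eq_zero.1 h0).resolve_right hys
  -- Here `yᵀKz = -zᵀKy`. The left side reduces to the term at `v`, since `y s = 0`; the right side
  -- is zero, since `z s = 0` and all other rows kill `y`. So `z` satisfies the equation of row `v`
  -- as well.
  have hzv0 : ∑ j ∈ S, K v j * z j = 0 := by
    have h0 := sum_mul_sum_eq_neg hskew y z
    rw [Finset.sum_eq_single_of_mem v hv fun i hi hiv => ?_,
      Finset.sum_eq_zero (s := S) (f := fun i => z i * _) fun i hi => ?_, neg_zero] at h0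
    · exact (mul_eq_zero.1 h0).resolve_left hyv
    · by_cases his : i = s
      · rw [his, hzs, zero_mul]
      · rw [hy i hi his, mul_zero]
    · by_cases his : i = s
      · rw [his, hys0, zero_mul]
      · rw [hz' i hi his hiv, mul_zero]
  refine h.eq_zero_of_erase hyS hy hys hyv hzS' hzv fun i hi his => ?_
  by_cases hiv : i = v
  · rw [hiv, hzv0]
  · exact hz' i hi his hiv

end LinearAlgebra

/-! ### Extracting disjoint paths and a matching from a non-singular matrix. -/

section Linkage

variable {V : Type*}

/-- A list of node-disjoint paths starting in the members of `A` (in this order), ending in `B`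
and with all inner vertices in `S`, together with a matching `N` of `S` that avoids the paths,
such that every vertex of `B` and `S` is covered. -/
structure IsLinkage (H : SimpleGraph V) (A : List V) (B S : Finset V)
    (L : List (Σ a b : V, H.Walk a b)) (N : Set (Sym2 V)) : Prop where
  starts : L.map (fun x => x.1) = A
  ends : ∀ x ∈ L, x.2.1 ∈ B
  inner : ∀ x ∈ L, ∀ v ∈ x.2.2.support, v ≠ x.1 → v ≠ x.2.1 → v ∈ S
  nodup : (L.flatMap fun x => x.2.2.support).Nodup
  subset : N ⊆ H.edgeSet
  matching_mem : ∀ e ∈ N, ∀ v ∈ e, v ∈ S ∧ ∀ x ∈ L, v ∉ x.2.2.support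
  matching : ∀ e ∈ N, ∀ e' ∈ N, ∀ v, v ∈ e → v ∈ e' → e = e'
  covers_ends : ∀ b ∈ B, ∃ x ∈ L, x.2.1 = b
  covers : ∀ s ∈ S, (∃ x ∈ L, s ∈ x.2.2.support) ∨ ∃ e ∈ N, s ∈ e

variable {H : SimpleGraph V} {A : List V} {B S : Finset V} {L : List (Σ a b : V, H.Walk a b)}
  {N : Set (Sym2 V)}

theorem IsLinkage.nil : IsLinkage H [] ∅ ∅ [] ∅ := by
  constructor <;> simp

theorem IsLinkage.mem_of_mem_support (h : IsLinkage H A B S L N) {x} (hx : x ∈ L) {v : V}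
    (hv : v ∈ x.2.2.support) : v ∈ A ∨ v ∈ B ∨ v ∈ S := by
  by_cases h1 : v = x.1
  · left; rw [← h.starts, h1]; exact List.mem_map_of_mem hx
  by_cases h2 : v = x.2.1
  · right; left; rw [h2]; exact h.ends x hx
  · exact .inr (.inr (h.inner x hx v hv h1 h2))

variable [DecidableEq V]

theorem IsLinkage.insert_matching_edge {s v : V}
    (h : IsLinkage H [] ∅ ((S.erase s).erase v) [] N) (hs : s ∈ S) (hv : v ∈ S)
    (hadj : H.Adj s v) : IsLinkage H [] ∅ S [] (insert s(s, v) N) where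
  starts := rfl
  ends := by simp
  inner := by simp
  nodup := by simp
  subset := Set.insert_subset hadj h.subset
  matching_mem e he w hw := by
    refine ⟨?_, by simp⟩
    rcases he with rfl | he
    · rcases Sym2.mem_iff.1 hw with rfl | rfl <;> assumption
    · exact Finset.mem_of_mem_erase (Finset.mem_of_mem_erase (h.matching_mem e he w hw).1)
  matching e he e' he' w hw hw' := by
    have key : ∀ f ∈ N, ∀ u ∈ f, u ∉ s(s, v) := fun f hf u hu hu' => by
      have := (h.matching_mem f hf u hu).1
      rcases Sym2.mem_iff.1 hu' with rfl | rfl <;> simp at this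
    rcases he with rfl | he <;> rcases he' with rfl | he'
    · rfl
    · exact absurd hw (key e' he' w hw')
    · exact absurd hw' (key e he w hw)
    · exact h.matching e he e' he' w hw hw'
  covers_ends := by simp
  covers w hw := by
    right
    by_cases hws : w = s
    · exact ⟨_, Set.mem_insert _ _, by simp [hws]⟩
    by_cases hwv : w = v
    · exact ⟨_, Set.mem_insert _ _, by simp [hwv]⟩
    rcases h.covers w (by simp [hw, hws, hwv]) with ⟨x, hx, -⟩ | ⟨e, he, hwe⟩
    · simp at hx
    · exact ⟨e, Set.mem_insert_of_mem _ he, hwe⟩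

theorem IsLinkage.cons_edge {a b : V} (hb : b ∈ B) (h : IsLinkage H A (B.erase b) S L N)
    (hadj : H.Adj a b) (haA : a ∉ A) (haB : a ∉ B) (haS : a ∉ S) (hbA : b ∉ A) (hbS : b ∉ S) :
    IsLinkage H (a :: A) B S (⟨a, b, .cons hadj .nil⟩ :: L) N where
  starts := by simp [h.starts]
  ends x hx := by
    rcases List.mem_cons.1 hx with rfl | hx
    · exact hb
    · exact Finset.mem_of_mem_erase (h.ends x hx)
  inner x hx w hw h1 h2 := by
    rcases List.mem_cons.1 hx with rfl | hx
    · simp at hw h1 h2; tauto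
    · exact h.inner x hx w hw h1 h2
  nodup := by
    have ha : a ∉ L.flatMap fun x => x.2.2.support := fun ha => by
      obtain ⟨x, hx, hax⟩ := List.mem_flatMap.1 ha
      have := h.mem_of_mem_support hx hax
      simp at this; tauto
    have hb : b ∉ L.flatMap fun x => x.2.2.support := fun hb => by
      obtain ⟨x, hx, hbx⟩ := List.mem_flatMap.1 hb
      have := h.mem_of_mem_support hx hbx
      simp at this; tauto
    rw [List.flatMap_cons]
    simp only [SimpleGraph.Walk.support_cons, SimpleGraph.Walk.support_nil, List.cons_append,
      List.nil_append, List.nodup_cons, List.mem_cons, not_or]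
    exact ⟨⟨hadj.ne, ha⟩, hb, h.nodup⟩
  subset := h.subset
  matching_mem e he w hw := by
    have h' := h.matching_mem e he w hw
    refine ⟨h'.1, fun x hx => ?_⟩
    rcases List.mem_cons.1 hx with rfl | hx
    · have := h'.1
      simp only [SimpleGraph.Walk.support_cons, SimpleGraph.Walk.support_nil, List.mem_cons,
        List.not_mem_nil, or_false, not_or]
      exact ⟨fun h => haS (h ▸ this), fun h => hbS (h ▸ this)⟩
    · exact h'.2 x hx
  matching := h.matching
  covers_ends c hc := by
    by_cases hcb : c = b
    · exact ⟨_, List.mem_cons_self, hcb.symm⟩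
    · obtain ⟨x, hx, hxc⟩ := h.covers_ends c (by simp [hc, hcb])
      exact ⟨x, List.mem_cons_of_mem _ hx, hxc⟩
  covers s hs := (h.covers s hs).imp_left fun ⟨x, hx, hsx⟩ =>
    ⟨x, List.mem_cons_of_mem _ hx, hsx⟩

/-- The path that starts in `v` is prolonged by the edge `av`, which turns `v` into an inner vertex.
Keeping the starts in a list makes this path the first one. -/
theorem IsLinkage.exists_cons_inner {a v : V} (hv : v ∈ S)
    (h : IsLinkage H (v :: A) B (S.erase v) L N)
    (hadj : H.Adj a v) (haA : a ∉ A) (haB : a ∉ B) (haS : a ∉ S) :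
    ∃ L', IsLinkage H (a :: A) B S L' N := by
  obtain _ | ⟨⟨v', b, p⟩, L⟩ := L
  · simpa using h.starts
  obtain ⟨rfl, hL⟩ : v' = v ∧ L.map (fun x => x.1) = A := by simpa using h.starts
  have hS : ∀ {w}, w ∈ S.erase v' → w ∈ S := Finset.mem_of_mem_erase
  refine ⟨⟨a, b, .cons hadj p⟩ :: L, ?_⟩
  constructor
  · simp [hL]
  · intro x hx
    rcases List.mem_cons.1 hx with rfl | hx
    · exact h.ends ⟨v', b, p⟩ List.mem_cons_self
    · exact h.ends x (List.mem_cons_of_mem _ hx)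
  · intro x hx w hw h1 h2
    rcases List.mem_cons.1 hx with rfl | hx
    · rw [SimpleGraph.Walk.support_cons, List.mem_cons] at hw
      by_cases hwv : w = v'
      · rwa [hwv]
      · exact hS (h.inner _ List.mem_cons_self w (hw.resolve_left h1) hwv h2)
    · exact hS (h.inner x (List.mem_cons_of_mem _ hx) w hw h1 h2)
  · have ha : a ∉ p.support ++ L.flatMap fun x => x.2.2.support := fun ha => by
      rw [← List.flatMap_cons (f := fun x : Σ a b : V, H.Walk a b => x.2.2.support)
        (x := ⟨v', b, p⟩)] at ha
      obtain ⟨x, hx, hax⟩ := List.mem_flatMap.1 ha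
      have := h.mem_of_mem_support hx hax
      rw [List.mem_cons] at this
      rcases this with (rfl | h') | h' | h'
      · exact haS hv
      · exact haA h'
      · exact haB h'
      · exact haS (hS h')
    have := h.nodup
    rw [List.flatMap_cons] at this ⊢
    rw [SimpleGraph.Walk.support_cons, List.cons_append]
    exact List.nodup_cons.2 ⟨ha, this⟩
  · exact h.subset
  · intro e he w hw
    have h' := h.matching_mem e he w hw
    refine ⟨hS h'.1, fun x hx => ?_⟩
    rcases List.mem_cons.1 hx with rfl | hx
    · rw [SimpleGraph.Walk.support_cons, List.mem_cons, not_or]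
      exact ⟨fun h => haS ((show w = a from h) ▸ hS h'.1), h'.2 _ List.mem_cons_self⟩
    · exact h'.2 x (List.mem_cons_of_mem _ hx)
  · exact h.matching
  · intro c hc
    obtain ⟨x, hx, hxc⟩ := h.covers_ends c hc
    rcases List.mem_cons.1 hx with rfl | hx
    · exact ⟨_, List.mem_cons_self, hxc⟩
    · exact ⟨x, List.mem_cons_of_mem _ hx, hxc⟩
  · intro s hs
    by_cases hsv : s = v'
    · refine .inl ⟨_, List.mem_cons_self, ?_⟩
      simp [hsv]
    · refine (h.covers s (by simp [hs, hsv])).imp_left ?_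
      rintro ⟨x, hx, hsx⟩
      rcases List.mem_cons.1 hx with rfl | hx
      · exact ⟨_, List.mem_cons_self, by simp [hsx]⟩
      · exact ⟨x, List.mem_cons_of_mem _ hx, hsx⟩

/-- If the rows `A ∪ S` and columns `B ∪ S` of a matrix supported on the edges of `H` and
skew-symmetric on `S` form a nonsingular submatrix, there is a linkage from `A` to `B`. -/
theorem TrivialKernelOn.exists_isLinkage {R : Type*} [CommRing R] [IsDomain R] {K : V → V → R} :
    ∀ {A : List V} {B S : Finset V}, A.Nodup → Disjoint A.toFinset B → Disjoint A.toFinset S →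
      Disjoint B S →
      (∀ i ∈ A.toFinset ∪ S, ∀ j ∈ B ∪ S, K i j ≠ 0 → H.Adj i j) →
      (∀ i ∈ S, ∀ j ∈ S, K j i = - K i j) → (∀ i, K i i = 0) →
      TrivialKernelOn K (A.toFinset ∪ S) (B ∪ S) → ∃ L N, IsLinkage H A B S L N := by
  intro A B S hA hAB hAS hBS hadj hskew hdiag hK
  induction hn : A.length + S.card using Nat.strong_induction_on generalizing A B S with
  | _ n ih =>
  subst hn
  obtain _ | ⟨a, A⟩ := A
  · simp only [List.toFinset_nil, Finset.empty_union] at hK hadj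
    -- Squareness leaves no ends once there are no starts.
    have hB : B = ∅ := by
      have := hK.1
      rw [Finset.card_union_of_disjoint hBS] at this
      exact Finset.card_eq_zero.1 (by omega)
    subst hB
    rw [Finset.empty_union] at hK hadj
    obtain rfl | ⟨s, hs⟩ := S.eq_empty_or_nonempty
    · exact ⟨[], ∅, .nil⟩
    obtain ⟨v, hv, hvs, hsv, hK'⟩ := hK.exists_erase_erase hskew hdiag hs
    have hsub : (S.erase s).erase v ⊆ S := (Finset.erase_subset _ _).trans (Finset.erase_subset _ _)
    obtain ⟨L, N, h⟩ := ih _ (by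
        have := Finset.card_lt_card (Finset.erase_ssubset hs)
        have := Finset.card_le_card (Finset.erase_subset v (S.erase s))
        simp; omega) (A := []) (B := ∅) (S := (S.erase s).erase v) hA (by simp) (by simp)
      (by simp) (by
        simp only [List.toFinset_nil, Finset.empty_union]
        exact fun i hi j hj => hadj i (hsub hi) j (hsub hj))
      (fun i hi j hj => hskew i (hsub hi) j (hsub hj)) (by simpa using hK') rfl
    obtain rfl : L = [] := by simpa using h.starts
    exact ⟨[], _, h.insert_matching_edge hs hv (hadj s hs v hv hsv)⟩
  · rw [List.nodup_cons] at hA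
    simp only [List.toFinset_cons, Finset.insert_union, Finset.disjoint_insert_left] at *
    obtain ⟨v, hv, hav, hK'⟩ := hK.exists_erase (Finset.mem_insert_self a _)
    have hadjav := hadj a (Finset.mem_insert_self a _) v hv hav
    have ha : a ∉ A.toFinset ∪ S := by simp [hA.1, hAS.1]
    rw [Finset.erase_insert ha] at hK'
    by_cases hvB : v ∈ B
    · have hvS : v ∉ S := Finset.disjoint_left.1 hBS hvB
      have hvA : v ∉ A := fun h => Finset.disjoint_left.1 hAB.2 (by simpa using h) hvB
      have hsub : B.erase v ⊆ B := Finset.erase_subset _ _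
      obtain ⟨L, N, h⟩ := ih _ (by simp) hA.2 (hAB.2.mono_right hsub) hAS.2 (hBS.mono_left hsub)
        (fun i hi j hj => hadj i (Finset.mem_insert_of_mem hi) j
          (Finset.union_subset_union_left hsub hj)) hskew
        (by rwa [Finset.erase_union_distrib, Finset.erase_eq_of_notMem hvS] at hK') rfl
      exact ⟨_, _, h.cons_edge hvB hadjav hA.1 hAB.1 hAS.1 hvA hvS⟩
    · have hvS : v ∈ S := (Finset.mem_union.1 hv).resolve_left hvB
      have hvA : v ∉ A := fun h => Finset.disjoint_left.1 hAS.2 (by simpa using h) hvS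
      have hsub : S.erase v ⊆ S := Finset.erase_subset _ _
      -- Deleting row `a` and column `v` keeps row `v`. The remaining matrix is thus an instance of
      -- the same problem, with `v` moved from `S` to the starts; the number of starts is unchanged
      -- and `S` shrinks.
      have hrow : insert v (A.toFinset ∪ S.erase v) = A.toFinset ∪ S := by
        ext w
        by_cases hwv : w = v <;> simp [hwv, hvS]
      have hcol : B ∪ S.erase v = (B ∪ S).erase v := by
        ext w
        by_cases hwv : w = v <;> simp [hwv, hvB]
      obtain ⟨L, N, h⟩ := ih (m := (v :: A).length + (S.erase v).card) (by
          have := Finset.card_lt_card (Finset.erase_ssubset hvS)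
          simp only [List.length_cons]; omega) (A := v :: A) (B := B) (S := S.erase v)
        (List.nodup_cons.2 ⟨hvA, hA.2⟩)
        (by rw [List.toFinset_cons, Finset.disjoint_insert_left]; exact ⟨hvB, hAB.2⟩)
        (by
          rw [List.toFinset_cons, Finset.disjoint_insert_left]
          exact ⟨Finset.notMem_erase v S, hAS.2.mono_right hsub⟩) (hBS.mono_right hsub)
        (by
          rw [List.toFinset_cons, Finset.insert_union, hrow]
          exact fun i hi j hj => hadj i (Finset.mem_insert_of_mem hi) j
            (Finset.union_subset_union_right hsub hj))
        (fun i hi j hj => hskew i (hsub hi) j (hsub hj))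
        (by rw [List.toFinset_cons, Finset.insert_union, hrow, hcol]; exact hK') rfl
      obtain ⟨L', h'⟩ := h.exists_cons_inner hvS hadjav hA.1 hAB.1 hAS.1
      exact ⟨L', N, h'⟩

end Linkage

/-! ### Non-singular matrices whose rows and columns have different index types. -/

section Nonsingular

variable {m n R : Type*} [Fintype m] [DecidableEq m] [CommRing R]

theorem Matrix.IsNonsingular.of_map {R' : Type*} [CommRing R'] (φ : R →+* R') {A : Matrix m n R}
    (h : (A.map φ).IsNonsingular) : A.IsNonsingular := by
  obtain ⟨e, he⟩ := h
  refine ⟨e, fun h0 => he ?_⟩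
  have := φ.map_det (A.submatrix id e)
  rw [h0, map_zero] at this
  exact this.symm

/-- The determinant of a sum, expanded along the rows: some choice of the rows of the summands
gives a nonzero contribution. -/
theorem Matrix.IsNonsingular.exists_rows {A D : Matrix m n R} (h : (A + D).IsNonsingular) :
    ∃ s : Finset m, (∀ i ∈ s, ∃ j, D i j ≠ 0) ∧
      (Matrix.of fun i j => if i ∈ s then D i j else A i j).IsNonsingular := by
  obtain ⟨e, he⟩ := h
  have key := Matrix.detRowAlternating.map_add_univ (D.submatrix id e) (A.submatrix id e)
  have hne : ∑ s : Finset m, Matrix.detRowAlternating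
      (s.piecewise (D.submatrix id e) (A.submatrix id e)) ≠ 0 := by
    rw [← key]
    convert he using 2
    rw [add_comm]; rfl
  obtain ⟨s, -, hs⟩ := Finset.exists_ne_zero_of_sum_ne_zero hne
  refine ⟨s, fun i hi => ?_, e, ?_⟩
  -- A row chosen from `D` that is identically zero would make the contribution vanish.
  · by_contra! hD
    refine hs (Matrix.det_eq_zero_of_row_eq_zero i fun j => ?_)
    exact (congrFun (Finset.piecewise_eq_of_mem s (fun i => D.submatrix id e i)
      (fun i => A.submatrix id e i) hi) j).trans (hD _)
  · refine fun h0 => hs ((congrArg Matrix.det ?_).trans h0)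
    ext i j
    refine (congrFun (apply_ite id _ _ _) j).trans ?_
    by_cases hi : i ∈ s <;> simp [hi]

theorem Matrix.isNonsingular_iff [Fintype n] [IsDomain R] {A : Matrix m n R} :
    A.IsNonsingular ↔ Fintype.card m = Fintype.card n ∧ ∀ y, A.mulVec y = 0 → y = 0 := by
  have key (e : m ≃ n) : (A.submatrix id e).det ≠ 0 ↔ ∀ y, A.mulVec y = 0 → y = 0 := by
    rw [Ne, ← Matrix.exists_mulVec_eq_zero_iff]
    push Not
    constructor
    · intro h y hy
      by_contra hy0
      refine h (y ∘ e) (fun h0 => hy0 ?_) ?_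
      · ext j
        simpa using congrFun h0 (e.symm j)
      · rw [Matrix.submatrix_mulVec_equiv]
        have : (y ∘ e) ∘ e.symm = y := by ext; simp
        rw [this, hy]; rfl
    · intro h v hv0 hv
      rw [Matrix.submatrix_mulVec_equiv] at hv
      refine hv0 ?_
      ext i
      have := congrFun (h _ hv) (e i)
      simpa using this
  constructor
  · rintro ⟨e, he⟩
    exact ⟨Fintype.card_congr e, (key e).1 he⟩
  · rintro ⟨hc, h⟩
    exact ⟨Fintype.equivOfCardEq hc, (key _).2 h⟩

theorem Matrix.IsNonsingular.eq_zero_of_mulVec [Fintype n] [IsDomain R] {A : Matrix m n R} (h : A.IsNonsingular) {y : n → R}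
    (hy : ∀ i, ∑ j, A i j * y j = 0) : y = 0 :=
  (Matrix.isNonsingular_iff.1 h).2 y (funext hy)

/-- The number of columns that vanish outside some rows is at most the number of these rows. -/
theorem Matrix.IsNonsingular.card_columns_le [Fintype n] [IsDomain R] {α β : Type*} [Fintype α] [Fintype β]
    {A : Matrix m n R} (h : A.IsNonsingular) {f : α → m} {g : β → n} (hg : Function.Injective g)
    (hfg : ∀ i ∉ Set.range f, ∀ j, A i (g j) = 0) : Fintype.card β ≤ Fintype.card α := by
  let l : (β → R) →ₗ[R] (α → R) := Matrix.mulVecLin (A.submatrix f g)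
  have hl : Function.Injective l := by
    rw [injective_iff_map_eq_zero]
    intro c hc
    have h0 := h.eq_zero_of_mulVec (y := Function.extend g c 0) fun i => by
      have hsum : ∑ j, A i j * Function.extend g c 0 j = ∑ j, A i (g j) * c j := by
        symm
        refine Fintype.sum_of_injective g hg _ _ (fun j hj => ?_) fun j => ?_
        · rw [Function.extend_apply' _ _ _ fun ⟨x, hx⟩ => hj ⟨x, hx⟩, Pi.zero_apply, mul_zero]
        · rw [hg.extend_apply]
      rw [hsum]
      by_cases hi : i ∈ Set.range f
      · obtain ⟨x, rfl⟩ := hi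
        exact congrFun hc x
      · exact Finset.sum_eq_zero fun j _ => by rw [hfg i hi j, zero_mul]
    ext j
    simpa [hg.extend_apply] using congrFun h0 (g j)
  simpa using LinearMap.finrank_le_finrank_of_injective hl

variable [Fintype n] [DecidableEq n]

theorem Matrix.IsNonsingular.transpose {A : Matrix m n R} (h : A.IsNonsingular) :
    A.transpose.IsNonsingular := by
  obtain ⟨e, he⟩ := h
  refine ⟨e.symm, ?_⟩
  rw [← Matrix.det_transpose, ← Matrix.det_submatrix_equiv_self e.symm] at he
  convert he using 2
  ext i j
  simp

theorem Matrix.IsNonsingular.exists_columns {A D : Matrix m n R} (h : (A + D).IsNonsingular) :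
    ∃ s : Finset n, (∀ j ∈ s, ∃ i, D i j ≠ 0) ∧
      (Matrix.of fun i j => if j ∈ s then D i j else A i j).IsNonsingular := by
  obtain ⟨s, hs, hs'⟩ := Matrix.IsNonsingular.exists_rows (A := A.transpose) (D := D.transpose)
    (by simpa using h.transpose)
  exact ⟨s, hs, hs'.transpose⟩

variable [IsDomain R]

theorem Matrix.IsNonsingular.eq_zero_of_vecMul {A : Matrix m n R} (h : A.IsNonsingular) {y : m → R}
    (hy : ∀ j, ∑ i, A i j * y i = 0) : y = 0 :=
  h.transpose.eq_zero_of_mulVec hy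

theorem Matrix.IsNonsingular.card_rows_le {α β : Type*} [Fintype α] [Fintype β]
    {A : Matrix m n R} (h : A.IsNonsingular) {f : α → m} {g : β → n} (hf : Function.Injective f)
    (hfg : ∀ i, ∀ j ∉ Set.range g, A (f i) j = 0) : Fintype.card α ≤ Fintype.card β :=
  h.transpose.card_columns_le hf fun j hj i => hfg i j hj

end Nonsingular

/-! ### Represented matroids, and bases of a contraction plus a free matroid. -/

section Matroid

/-- The extension of a family of vectors on `T` by `0`. -/
def extendZero {V F : Type*} [Zero F] [DecidableEq V] {r : ℕ} {T : Finset V} (w : T → Fin r → F)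
    (v : V) : Fin r → F :=
  if h : v ∈ T then w ⟨v, h⟩ else 0

theorem extendZero_of_mem {V F : Type*} [Zero F] [DecidableEq V] {r : ℕ} {T : Finset V}
    (w : T → Fin r → F) {v : V} (h : v ∈ T) : extendZero w v = w ⟨v, h⟩ :=
  dif_pos h

/-- Coefficients are functions on all of `V` that vanish off `J`, and sums run over all of `T`, to
match the row equations of the block matrix. -/
theorem RepresentsMatroid.indep_iff {V F : Type*} [DecidableEq V] [Field F] {r : ℕ} {T : Finset V}
    {w : T → Fin r → F} {M : Matroid V} (h : RepresentsMatroid (F := F) w M) {J : Finset V}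
    (hJ : J ⊆ T) :
    M.Indep (J : Set V) ↔ ∀ c : V → F, (∀ v ∉ J, c v = 0) →
      (∀ a, ∑ v ∈ T, extendZero w v a * c v = 0) → c = 0 := by
  have hJ' : (J : Set V) = Subtype.val '' ((J.subtype (· ∈ T) : Finset T) : Set T) := by
    ext v
    simpa using fun hv => hJ hv
  rw [hJ', h.2, linearIndepOn_finset_iff]
  have hsum (c : V → F) (hc : ∀ v ∉ J, c v = 0) (a : Fin r) :
      ∑ v ∈ T, extendZero w v a * c v = (∑ v ∈ J.subtype (· ∈ T), c v • w v) a := by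
    rw [← Finset.sum_coe_sort, Finset.sum_apply]
    symm
    have h1 : ∀ v : T, (c v • w v) a = extendZero w v a * c v := fun v => by
      rw [extendZero_of_mem w v.2]; simp [mul_comm]
    simp only [h1]
    refine Finset.sum_subset (Finset.subset_univ _) fun v _ hv => ?_
    rw [hc v (by simpa using hv), mul_zero]
  constructor
  · intro hli c hc hc0
    ext v
    by_cases hv : v ∈ J
    · exact hli (fun v => c v) (funext fun a => by rw [← hsum c hc, hc0]; rfl) ⟨v, hJ hv⟩
        (by simpa using hv)
    · exact hc v hv
  · intro hk f hf v hv
    have hc : ∀ v ∉ J, (fun v => if h : v ∈ J then f ⟨v, hJ h⟩ else 0) v = 0 := fun v hv => by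
      simp [hv]
    have := congrFun (hk _ hc fun a => by
      rw [hsum _ hc]
      refine (congrFun (Finset.sum_congr rfl fun u hu => ?_) a).trans (congrFun hf a)
      rw [dif_pos (by simpa using hu)]) v
    rw [dif_pos (by simpa using hv)] at this
    exact this

theorem Matroid.IsBase.card_eq {V : Type*} {N : Matroid V} {r : ℕ} {J : Finset V}
    (hJ : N.IsBase (J : Set V)) (hr : N.eRank = r) : J.card = r := by
  have := hJ.encard_eq_eRank
  rw [hr, Set.encard_coe_eq_coe_finsetCard] at this
  exact_mod_cast this

/-- As the rank equals the dimension `r` of the ambient space, the vectors of a basis form a square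
matrix with independent columns, whose left kernel is therefore trivial too. -/
theorem RepresentsMatroid.eq_zero_of_isBase {V F : Type*} [DecidableEq V] [Field F] {r : ℕ}
    {T : Finset V} {w : T → Fin r → F} {M : Matroid V} (h : RepresentsMatroid (F := F) w M)
    (hr : M.eRank = r) {J : Finset V} (hJ : J ⊆ T) (hB : M.IsBase (J : Set V)) {p : Fin r → F}
    (hp : ∀ u ∈ J, ∑ b, extendZero w u b * p b = 0) : p = 0 := by
  have hcard := hB.card_eq hr
  have hA : (Matrix.of fun (b : Fin r) (u : J) => extendZero w u b).IsNonsingular := by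
    rw [Matrix.isNonsingular_iff]
    refine ⟨by simp [hcard], fun y hy => ?_⟩
    have hc := (h.indep_iff hJ).1 hB.indep (fun v => if h : v ∈ J then y ⟨v, h⟩ else 0)
      (fun v hv => by simp [hv]) fun a => by
        rw [← Finset.sum_subset hJ fun v _ hv => by simp [hv], ← Finset.sum_coe_sort]
        simpa [Matrix.mulVec, dotProduct] using congrFun hy a
    ext u
    simpa using congrFun hc u
  exact hA.eq_zero_of_vecMul fun u => hp u u.2

theorem Matroid.Indep.isBase_of_card {V : Type*} {M : Matroid V} {J : Finset V} {r : ℕ}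
    (hJ : M.Indep (J : Set V)) (hr : M.eRank = r) (hc : r ≤ J.card) : M.IsBase (J : Set V) := by
  obtain ⟨B, hB, hJB⟩ := hJ.exists_isBase_superset
  have hBr : B.encard = r := by rw [hB.encard_eq_eRank, hr]
  have hfin : B.Finite := Set.finite_of_encard_eq_coe hBr
  have : (J : Set V) = B := hfin.eq_of_subset_of_encard_le' hJB (by
    rw [hBr, Set.encard_coe_eq_coe_finsetCard]; exact_mod_cast hc)
  rwa [this]

theorem Matroid.disjointSum_contract_freeOn_isBase_iff {V : Type*} [DecidableEq V] {M : Matroid V}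
    {I A C : Finset V} (hI : M.Indep (I : Set V))
    (hd : Disjoint (M.contract (I : Set V)).E (Matroid.freeOn (C : Set V)).E)
    (hA : (A : Set V) ⊆ M.E \ I) :
    (Matroid.disjointSum (M.contract (I : Set V)) (Matroid.freeOn (C : Set V)) hd).IsBase
      ((A ∪ C : Finset V) : Set V) ↔ M.IsBase ((I ∪ A : Finset V) : Set V) := by
  have hAI : Disjoint (A : Set V) (I : Set V) :=
    Set.disjoint_left.2 fun v hv => (hA hv).2
  have h1 : ((A ∪ C : Finset V) : Set V) ∩ (M.E \ I) = A := by
    rw [Matroid.contract_ground, Matroid.freeOn_ground] at hd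
    rw [Finset.coe_union, Set.union_inter_distrib_right, Set.inter_eq_left.2 hA,
      hd.symm.inter_eq, Set.union_empty]
  have h2 : ((A ∪ C : Finset V) : Set V) ∩ C = C := by simp
  have h3 : ((A ∪ C : Finset V) : Set V) ⊆ M.E \ I ∪ C := by
    rw [Finset.coe_union]
    exact Set.union_subset_union_left _ hA
  simp only [Matroid.disjointSum_isBase_iff, Matroid.contract_ground, Matroid.freeOn_ground, h1, h2,
    Matroid.freeOn_isBase_iff, hI.contract_isBase_iff]
  rw [Finset.coe_union I A, Set.union_comm]
  tauto

end Matroid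

/-! ### Block matrices of the shape of `Z(M)` and their row equations. -/

namespace PathMatchingInstance

variable {V : Type*} [DecidableEq V]

/-- The block matrix of the shape of `Z(M)` with blocks given by arbitrary functions. -/
def blockMatrix (G : PathMatchingInstance V) {R : Type*} [CommRing R] {r : ℕ} (M : Set (Sym2 V))
    (q₁ q₂ : V → Fin r → R) (K : V → V → R) (δ₁ δ₂ : V → R) :
    Matrix (G.ZRow r M) (G.ZCol r M) R :=
  Matrix.of fun i j =>
    match i, j with
    | .inl a, .inr (.inl v) => q₁ v a
    | .inl a, .inr (.inr (.inl v)) => q₁ v a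
    | .inr (.inl u), .inl b => q₂ u b
    | .inr (.inr (.inl u)), .inl b => q₂ u b
    | .inr (.inr (.inl u)), .inr (.inr (.inr (.inl v))) =>
        Matrix.diagonal (fun w : G.exposed₂ M => δ₂ w) u v
    | .inr (.inr (.inr (.inl u))), .inr (.inr (.inl v)) =>
        Matrix.diagonal (fun w : G.exposed₁ M => δ₁ w) u v
    | .inr (.inr (.inr (.inl u))), .inr (.inr (.inr (.inl v))) => K u v
    | .inr (.inr (.inr (.inl u))), .inr (.inr (.inr (.inr v))) => K u v
    | .inr (.inr (.inr (.inr u))), .inr (.inr (.inr (.inl v))) => K u v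
    | .inr (.inr (.inr (.inr u))), .inr (.inr (.inr (.inr v))) => K u v
    | _, _ => 0

variable (G : PathMatchingInstance V) (M : Set (Sym2 V)) {F R : Type*} [Field F] [CommRing R]
  {r : ℕ}

theorem Z_eq_blockMatrix (Q₁ : Matrix (Fin r) G.T₁ F) (Q₂ : Matrix G.T₂ (Fin r) F)
    (ε : V → V → ℤˣ) :
    G.Z Q₁ Q₂ ε M = G.blockMatrix M (fun v a => MvPolynomial.C (extendZero Q₁.col v a))
      (fun v a => MvPolynomial.C (extendZero Q₂.row v a)) (fun i j => G.edgeMatrix F ε i j)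
      (fun v => MvPolynomial.X (Indet.d₁ v)) (fun v => MvPolynomial.X (Indet.d₂ v)) := by
  have h₁ (v : V) (hv : v ∈ G.T₁) (a : Fin r) : extendZero Q₁.col v a = Q₁ a ⟨v, hv⟩ := by
    rw [extendZero_of_mem _ hv]; rfl
  have h₂ (v : V) (hv : v ∈ G.T₂) (a : Fin r) : extendZero Q₂.row v a = Q₂ ⟨v, hv⟩ a := by
    rw [extendZero_of_mem _ hv]; rfl
  refine Matrix.ext fun i j => ?_
  rcases i with a | u | u | u | u <;> rcases j with b | v | v | v | v <;>
    first
      | rfl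
      | exact congrArg (⇑MvPolynomial.C) (h₁ _ (coveredIn_subset _ _ v.2) _).symm
      | exact congrArg (⇑MvPolynomial.C) (h₁ _ (Finset.sdiff_subset v.2) _).symm
      | exact congrArg (⇑MvPolynomial.C) (h₂ _ (coveredIn_subset _ _ u.2) _).symm
      | exact congrArg (⇑MvPolynomial.C) (h₂ _ (Finset.sdiff_subset u.2) _).symm

theorem blockMatrix_map {R' : Type*} [CommRing R'] (φ : R →+* R') (q₁ q₂ : V → Fin r → R)
    (K : V → V → R) (δ₁ δ₂ : V → R) :
    (G.blockMatrix M q₁ q₂ K δ₁ δ₂).map φ = G.blockMatrix M (fun v a => φ (q₁ v a))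
      (fun v a => φ (q₂ v a)) (fun u v => φ (K u v)) (fun v => φ (δ₁ v)) (fun v => φ (δ₂ v)) := by
  have hdiag {A : Finset V} (d : A → R) (u v : A) :
      φ (Matrix.diagonal d u v) = Matrix.diagonal (fun w => φ (d w)) u v := by
    rw [Matrix.diagonal_apply, Matrix.diagonal_apply, apply_ite φ, map_zero]
  refine Matrix.ext fun i j => ?_
  rcases i with a | u | u | u | u <;> rcases j with b | v | v | v | v <;>
    first
      | rfl
      | exact map_zero φ
      | exact hdiag (fun w : G.exposed₁ M => δ₁ w) u v
      | exact hdiag (fun w : G.exposed₂ M => δ₂ w) u v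

/-- The vertices that index rows or columns of `X`. -/
noncomputable abbrev exposedRows (G : PathMatchingInstance V) (M : Set (Sym2 V)) : Finset V :=
  G.C₁ M ∪ G.exposedS M

noncomputable abbrev exposedColumns (G : PathMatchingInstance V) (M : Set (Sym2 V)) : Finset V :=
  G.C₂ M ∪ G.exposedS M

theorem exposed₁_disjoint_exposedRows : Disjoint (G.exposed₁ M) (G.exposedRows M) :=
  Finset.disjoint_union_right.2 ⟨G.exposed₁_disjoint_C₁ M,
    G.disj_T₁_S.mono Finset.sdiff_subset Finset.sdiff_subset⟩

theorem exposed₂_disjoint_exposedColumns : Disjoint (G.exposed₂ M) (G.exposedColumns M) :=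
  Finset.disjoint_union_right.2 ⟨G.exposed₂_disjoint_C₂ M,
    G.disj_T₂_S.mono Finset.sdiff_subset Finset.sdiff_subset⟩

theorem sum_covered_add_sum_exposed₁ (f : V → R) :
    ∑ v : coveredIn G.T₁ M, f v + ∑ v : G.exposed₁ M, f v = ∑ v ∈ G.T₁, f v := by
  rw [Finset.sum_coe_sort _ f, Finset.sum_coe_sort _ f, add_comm]
  exact Finset.sum_sdiff (coveredIn_subset _ _)

theorem sum_covered_add_sum_exposed₂ (f : V → R) :
    ∑ v : coveredIn G.T₂ M, f v + ∑ v : G.exposed₂ M, f v = ∑ v ∈ G.T₂, f v := by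
  rw [Finset.sum_coe_sort _ f, Finset.sum_coe_sort _ f, add_comm]
  exact Finset.sum_sdiff (coveredIn_subset _ _)

theorem sum_exposed₂_add_sum_exposedColumns (f : V → R) :
    ∑ v : G.exposed₂ M, f v + ∑ v : G.exposedColumns M, f v =
      ∑ v ∈ G.exposed₂ M ∪ G.exposedColumns M, f v := by
  rw [Finset.sum_coe_sort _ f, Finset.sum_coe_sort _ f,
    Finset.sum_union (G.exposed₂_disjoint_exposedColumns M)]

/-- The vector on the columns with entries `p`, `c` (on `T₁`) and `s` (on the columns of `X`). -/
def columnVector (p : Fin r → R) (c s : V → R) : G.ZCol r M → R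
  | .inl b => p b
  | .inr (.inl v) => c v
  | .inr (.inr (.inl v)) => c v
  | .inr (.inr (.inr (.inl v))) => s v
  | .inr (.inr (.inr (.inr v))) => s v

/-- Merging the two blocks of `T₁`-columns into `c`, and the two blocks of columns of `X` into `s`,
turns each row equation into a single sum over `T₁` or over the columns of `X`. -/
theorem exists_eq_columnVector (y : G.ZCol r M → R) : ∃ p c s, (∀ v ∉ G.T₁, c v = 0) ∧
    (∀ v ∉ G.exposed₂ M ∪ G.exposedColumns M, s v = 0) ∧ y = G.columnVector M p c s := by
  refine ⟨fun b => y (.inl b), fun v => if h : v ∈ coveredIn G.T₁ M then y (.inr (.inl ⟨v, h⟩)) else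
    if h : v ∈ G.exposed₁ M then y (.inr (.inr (.inl ⟨v, h⟩))) else 0,
    fun v => if h : v ∈ G.exposed₂ M then y (.inr (.inr (.inr (.inl ⟨v, h⟩)))) else
    if h : v ∈ G.exposedColumns M then y (.inr (.inr (.inr (.inr ⟨v, h⟩)))) else 0, ?_, ?_, ?_⟩
  · intro v hv
    have h1 : v ∉ coveredIn G.T₁ M := fun h => hv (coveredIn_subset _ _ h)
    have h2 : v ∉ G.exposed₁ M := fun h => hv (Finset.sdiff_subset h)
    simp [h1, h2]
  · intro v hv
    rw [Finset.mem_union, not_or] at hv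
    exact (dif_neg hv.1).trans (dif_neg hv.2)
  · funext j
    rcases j with b | v | v | v | v
    · rfl
    · simp [columnVector]
    · have : (v : V) ∉ coveredIn G.T₁ M := (Finset.mem_sdiff.1 v.2).2
      simp [columnVector, this]
    · simp [columnVector]
    · have : (v : V) ∉ G.exposed₂ M :=
        Finset.disjoint_right.1 (G.exposed₂_disjoint_exposedColumns M) v.2
      simp only [columnVector, dif_neg this, dif_pos v.2]

section Rows

variable (q₁ q₂ : V → Fin r → R) (K : V → V → R) (δ₁ δ₂ : V → R) (p : Fin r → R) (c s : V → R)

theorem blockMatrix_mul_columnVector_inl (a : Fin r) :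
    ∑ j, G.blockMatrix M q₁ q₂ K δ₁ δ₂ (.inl a) j * G.columnVector M p c s j =
      ∑ v ∈ G.T₁, q₁ v a * c v := by
  rw [← G.sum_covered_add_sum_exposed₁ M]
  simp [Fintype.sum_sum_type, blockMatrix, columnVector]

theorem blockMatrix_mul_columnVector_covered (u : coveredIn G.T₂ M) :
    ∑ j, G.blockMatrix M q₁ q₂ K δ₁ δ₂ (.inr (.inl u)) j * G.columnVector M p c s j =
      ∑ b, q₂ u b * p b := by
  simp [Fintype.sum_sum_type, blockMatrix, columnVector]

theorem blockMatrix_mul_columnVector_exposed₂ (u : G.exposed₂ M) :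
    ∑ j, G.blockMatrix M q₁ q₂ K δ₁ δ₂ (.inr (.inr (.inl u))) j * G.columnVector M p c s j =
      ∑ b, q₂ u b * p b + δ₂ u * s u := by
  simp [Fintype.sum_sum_type, blockMatrix, columnVector, Matrix.diagonal_apply]

theorem blockMatrix_mul_columnVector_exposed₁ (u : G.exposed₁ M) :
    ∑ j, G.blockMatrix M q₁ q₂ K δ₁ δ₂ (.inr (.inr (.inr (.inl u)))) j *
      G.columnVector M p c s j =
      δ₁ u * c u + ∑ v ∈ G.exposed₂ M ∪ G.exposedColumns M, K u v * s v := by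
  rw [← G.sum_exposed₂_add_sum_exposedColumns M]
  simp [Fintype.sum_sum_type, blockMatrix, columnVector, Matrix.diagonal_apply]

theorem blockMatrix_mul_columnVector_inr (u : G.exposedRows M) :
    ∑ j, G.blockMatrix M q₁ q₂ K δ₁ δ₂ (.inr (.inr (.inr (.inr u)))) j *
      G.columnVector M p c s j =
      ∑ v ∈ G.exposed₂ M ∪ G.exposedColumns M, K u v * s v := by
  rw [← G.sum_exposed₂_add_sum_exposedColumns M]
  simp [Fintype.sum_sum_type, blockMatrix, columnVector]

end Rows

theorem covered_disjoint_of_subset_exposed₁ {A : Finset V} (hA : A ⊆ G.exposed₁ M) :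
    Disjoint (coveredIn G.T₁ M) A :=
  (Finset.disjoint_sdiff).mono_right hA

theorem covered_disjoint_of_subset_exposed₂ {A : Finset V} (hA : A ⊆ G.exposed₂ M) :
    Disjoint (coveredIn G.T₂ M) A :=
  (Finset.disjoint_sdiff).mono_right hA

end PathMatchingInstance

/-! ### The block matrix of one choice `A₁`, `A₂` and its three factors. -/

namespace PathMatchingInstance

variable {V : Type*} [DecidableEq V] (G : PathMatchingInstance V) (M : Set (Sym2 V))
  {F R : Type*} [Field F] [CommRing R] {r : ℕ}

theorem union_covered_subset₁ {A₁ : Finset V} (hA₁ : A₁ ⊆ G.exposed₁ M) :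
    coveredIn G.T₁ M ∪ A₁ ⊆ G.T₁ :=
  Finset.union_subset (coveredIn_subset _ _) (hA₁.trans Finset.sdiff_subset)

theorem union_covered_subset₂ {A₂ : Finset V} (hA₂ : A₂ ⊆ G.exposed₂ M) :
    coveredIn G.T₂ M ∪ A₂ ⊆ G.T₂ :=
  Finset.union_subset (coveredIn_subset _ _) (hA₂.trans Finset.sdiff_subset)

theorem card_ZRow : Fintype.card (G.ZRow r M) = r + ((coveredIn G.T₂ M).card +
    ((G.exposed₂ M).card + ((G.exposed₁ M).card + (G.exposedRows M).card))) := by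
  simp only [Fintype.card_sum, Fintype.card_fin, Fintype.card_coe]

theorem card_ZCol : Fintype.card (G.ZCol r M) = r + ((coveredIn G.T₁ M).card +
    ((G.exposed₁ M).card + ((G.exposed₂ M).card + (G.exposedColumns M).card))) := by
  simp only [Fintype.card_sum, Fintype.card_fin, Fintype.card_coe]

variable {G M} {w₁ : G.T₁ → Fin r → F} {w₂ : G.T₂ → Fin r → F} {K : V → V → F} {δ₁ δ₂ : V → F}
  {A₁ A₂ : Finset V}

/-- The equations are solved in triangular order: the rows of `∂₂M ∪ A₂` force `p = 0`; the nonzero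
`δ₂` then confine `s` to `A₂` and the columns `C₂ ∪ S'`; the nonzero `δ₁` confine `c` to the basis
`∂₁M ∪ A₁`, so `c = 0`; what is left is the kernel of the part in `X`. -/
theorem isNonsingular_blockMatrix (hr₁ : G.M₁.eRank = r) (hr₂ : G.M₂.eRank = r)
    (hw₁ : RepresentsMatroid (F := F) w₁ G.M₁) (hw₂ : RepresentsMatroid (F := F) w₂ G.M₂)
    (hA₁ : A₁ ⊆ G.exposed₁ M) (hA₂ : A₂ ⊆ G.exposed₂ M)
    (hB₁ : G.M₁.IsBase ((coveredIn G.T₁ M ∪ A₁ : Finset V) : Set V))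
    (hB₂ : G.M₂.IsBase ((coveredIn G.T₂ M ∪ A₂ : Finset V) : Set V))
    (hδ₁ : ∀ u ∈ G.exposed₁ M, u ∉ A₁ → δ₁ u ≠ 0) (hδ₁' : ∀ u ∈ A₁, δ₁ u = 0)
    (hδ₂ : ∀ v ∈ G.exposed₂ M, v ∉ A₂ → δ₂ v ≠ 0) (hδ₂' : ∀ v ∈ A₂, δ₂ v = 0)
    (hK : ∀ u ∈ G.exposed₁ M, u ∉ A₁ → ∀ v, K u v = 0)
    (hX : TrivialKernelOn K (A₁ ∪ G.exposedRows M) (A₂ ∪ G.exposedColumns M)) :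
    (G.blockMatrix M (extendZero w₁) (extendZero w₂) K δ₁ δ₂).IsNonsingular := by
  have hc₁ := hB₁.card_eq hr₁
  have hc₂ := hB₂.card_eq hr₂
  have hX₁ := hX.1
  rw [Finset.card_union_of_disjoint (G.covered_disjoint_of_subset_exposed₁ M hA₁)] at hc₁
  rw [Finset.card_union_of_disjoint (G.covered_disjoint_of_subset_exposed₂ M hA₂)] at hc₂
  rw [Finset.card_union_of_disjoint ((G.exposed₁_disjoint_exposedRows M).mono_left hA₁),
    Finset.card_union_of_disjoint ((G.exposed₂_disjoint_exposedColumns M).mono_left hA₂)] at hX₁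
  rw [Matrix.isNonsingular_iff]
  refine ⟨by rw [card_ZRow, card_ZCol]; omega, fun y hy => ?_⟩
  replace hy : ∀ i, ∑ j, G.blockMatrix M (extendZero w₁) (extendZero w₂) K δ₁ δ₂ i j * y j = 0 :=
    fun i => congrFun hy i
  obtain ⟨p, c, s, hc, hs, rfl⟩ := G.exists_eq_columnVector M y
  have h1 := fun a => (blockMatrix_mul_columnVector_inl ..).symm.trans (hy (.inl a))
  have h2 := fun u => (blockMatrix_mul_columnVector_covered ..).symm.trans (hy (.inr (.inl u)))
  have h3 := fun u => (blockMatrix_mul_columnVector_exposed₂ ..).symm.trans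
    (hy (.inr (.inr (.inl u))))
  have h4 := fun u => (blockMatrix_mul_columnVector_exposed₁ ..).symm.trans
    (hy (.inr (.inr (.inr (.inl u)))))
  have h5 := fun u => (blockMatrix_mul_columnVector_inr ..).symm.trans
    (hy (.inr (.inr (.inr (.inr u)))))
  clear hy
  obtain rfl : p = 0 := by
    refine hw₂.eq_zero_of_isBase hr₂ (G.union_covered_subset₂ M hA₂) hB₂ fun u hu => ?_
    rcases Finset.mem_union.1 hu with hu | hu
    · exact h2 ⟨u, hu⟩
    · have := h3 ⟨u, hA₂ hu⟩
      rwa [hδ₂' u hu, zero_mul, add_zero] at this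
  have hs' : ∀ v ∉ A₂ ∪ G.exposedColumns M, s v = 0 := fun v hv => by
    rw [Finset.mem_union, not_or] at hv
    by_cases hv' : v ∈ G.exposed₂ M
    · have := h3 ⟨v, hv'⟩
      simpa [hδ₂ v hv' hv.1] using this
    · exact hs v (by rw [Finset.mem_union, not_or]; exact ⟨hv', hv.2⟩)
  have hsum (u : V) : ∑ v ∈ G.exposed₂ M ∪ G.exposedColumns M, K u v * s v =
      ∑ v ∈ A₂ ∪ G.exposedColumns M, K u v * s v :=
    (Finset.sum_subset (Finset.union_subset_union_left hA₂) fun v _ hv => by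
      rw [hs' v hv, mul_zero]).symm
  simp only [hsum] at h4 h5
  obtain rfl : c = 0 := by
    refine (hw₁.indep_iff (G.union_covered_subset₁ M hA₁)).1 hB₁.indep c (fun v hv => ?_) h1
    rw [Finset.mem_union, not_or] at hv
    by_cases hv' : v ∈ G.exposed₁ M
    · have := h4 ⟨v, hv'⟩
      rw [Finset.sum_eq_zero fun w _ => by rw [hK v hv' hv.2, zero_mul], add_zero] at this
      exact (mul_eq_zero.1 this).resolve_left (hδ₁ v hv' hv.2)
    · exact hc v fun h => hv' (Finset.mem_sdiff.2 ⟨h, hv.1⟩)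
  obtain rfl : s = 0 := by
    refine hX.2 s hs' fun u hu => ?_
    rcases Finset.mem_union.1 hu with hu | hu
    · have := h4 ⟨u, hA₁ hu⟩
      rwa [hδ₁' u hu, zero_mul, zero_add] at this
    · exact h5 ⟨u, hu⟩
  funext j
  rcases j with b | v | v | v | v <;> rfl

variable [IsDomain R] {φ : F →+* R} {K' : V → V → R} {η₁ η₂ : V → R}

/-- A linear dependency of the vectors of `∂₁M ∪ A₁`, padded by zeros, is a kernel vector of the
whole matrix, as `D₁` has been removed at `A₁`. The map `φ` carries the scalars of the
representation into the ring of the remaining entries. -/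
theorem indep₁_of_isNonsingular_blockMatrix (hw₁ : RepresentsMatroid (F := F) w₁ G.M₁)
    (hA₁ : A₁ ⊆ G.exposed₁ M) (hδ₁ : ∀ u ∈ A₁, η₁ u = 0)
    (h : (G.blockMatrix M (fun v a => φ (extendZero w₁ v a)) (fun v a => φ (extendZero w₂ v a))
      K' η₁ η₂).IsNonsingular) :
    G.M₁.Indep ((coveredIn G.T₁ M ∪ A₁ : Finset V) : Set V) := by
  refine (hw₁.indep_iff (G.union_covered_subset₁ M hA₁)).2 fun c hc hc0 => ?_
  have h0 := h.eq_zero_of_mulVec (y := G.columnVector M 0 (fun v => φ (c v)) 0) fun i => by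
    rcases i with a | u | u | u | u
    · rw [blockMatrix_mul_columnVector_inl]
      simpa using congrArg φ (hc0 a)
    · rw [blockMatrix_mul_columnVector_covered]; simp
    · rw [blockMatrix_mul_columnVector_exposed₂]; simp
    · rw [blockMatrix_mul_columnVector_exposed₁]
      by_cases hu : (u : V) ∈ A₁
      · simp [hδ₁ u hu]
      · have : (u : V) ∉ coveredIn G.T₁ M := (Finset.mem_sdiff.1 u.2).2
        simp [hc u (by simp [hu, this])]
    · rw [blockMatrix_mul_columnVector_inr]; simp
  ext v
  by_cases hv : v ∈ coveredIn G.T₁ M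
  · exact (map_eq_zero φ).1 (congrFun h0 (.inr (.inl ⟨v, hv⟩)))
  by_cases hv' : v ∈ A₁
  · exact (map_eq_zero φ).1 (congrFun h0 (.inr (.inr (.inl ⟨v, hA₁ hv'⟩))))
  · exact hc v (by simp [hv, hv'])

/-- Since `Q₂` stands in the block matrix with its vectors as rows, a dependency is here a left
kernel vector. -/
theorem indep₂_of_isNonsingular_blockMatrix (hw₂ : RepresentsMatroid (F := F) w₂ G.M₂)
    (hA₂ : A₂ ⊆ G.exposed₂ M) (hδ₂ : ∀ v ∈ A₂, η₂ v = 0)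
    (h : (G.blockMatrix M (fun v a => φ (extendZero w₁ v a)) (fun v a => φ (extendZero w₂ v a))
      K' η₁ η₂).IsNonsingular) :
    G.M₂.Indep ((coveredIn G.T₂ M ∪ A₂ : Finset V) : Set V) := by
  refine (hw₂.indep_iff (G.union_covered_subset₂ M hA₂)).2 fun c hc hc0 => ?_
  have h0 := h.eq_zero_of_vecMul (y := fun
      | .inl _ => 0
      | .inr (.inl v) => φ (c v)
      | .inr (.inr (.inl v)) => φ (c v)
      | .inr (.inr (.inr _)) => 0) fun j => by
    rcases j with b | v | v | v | v
    · have := congrArg φ (hc0 b)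
      rw [← G.sum_covered_add_sum_exposed₂ M] at this
      simpa [Fintype.sum_sum_type, blockMatrix] using this
    · simp [Fintype.sum_sum_type, blockMatrix]
    · simp [Fintype.sum_sum_type, blockMatrix]
    · have : η₂ v * φ (c v) = 0 := by
        by_cases hv : (v : V) ∈ A₂
        · simp [hδ₂ v hv]
        · have : (v : V) ∉ coveredIn G.T₂ M := (Finset.mem_sdiff.1 v.2).2
          simp [hc v (by simp [hv, this])]
      simpa [Fintype.sum_sum_type, blockMatrix, Matrix.diagonal_apply] using this
    · simp [Fintype.sum_sum_type, blockMatrix]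
  ext v
  by_cases hv : v ∈ coveredIn G.T₂ M
  · exact (map_eq_zero φ).1 (congrFun h0 (.inr (.inl ⟨v, hv⟩)))
  by_cases hv' : v ∈ A₂
  · exact (map_eq_zero φ).1 (congrFun h0 (.inr (.inr (.inl ⟨v, hA₂ hv'⟩))))
  · exact hc v (by simp [hv, hv'])

/-- The `r` rows of `Q₁` and the rows of `exposed₁ M \ A₁`, which have lost their part in `X`, are
supported on the columns of `T₁`; independent rows cannot outnumber these columns. -/
theorem le_card₁_of_isNonsingular_blockMatrix (hA₁ : A₁ ⊆ G.exposed₁ M)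
    (hK₁ : ∀ u ∈ G.exposed₁ M, u ∉ A₁ → ∀ v, K' u v = 0)
    (h : (G.blockMatrix M (fun v a => φ (extendZero w₁ v a)) (fun v a => φ (extendZero w₂ v a))
      K' η₁ η₂).IsNonsingular) :
    r ≤ (coveredIn G.T₁ M ∪ A₁).card := by
  have hd₁ := G.covered_disjoint_of_subset_exposed₁ M hA₁
  have := h.card_rows_le (α := Fin r ⊕ (G.exposed₁ M \ A₁ : Finset V))
    (β := coveredIn G.T₁ M ⊕ G.exposed₁ M)
    (f := Sum.elim .inl fun u => .inr (.inr (.inr (.inl ⟨u, Finset.sdiff_subset u.2⟩))))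
    (g := Sum.elim (fun v => .inr (.inl v)) fun v => .inr (.inr (.inl v)))
    (Sum.inl_injective.sumElim (fun u v h => Subtype.ext
      (Subtype.mk.inj (Sum.inl.inj (Sum.inr.inj (Sum.inr.inj (Sum.inr.inj h))))))
      (fun _ _ => Sum.inl_ne_inr)) (by
      rintro (a | u) (b | v | v | v | v) hv
      all_goals first | rfl | simp at hv
      all_goals exact hK₁ _ (Finset.sdiff_subset u.2) (Finset.mem_sdiff.1 u.2).2 _)
  have hA := Finset.card_sdiff_add_card_eq_card hA₁
  rw [Finset.card_union_of_disjoint hd₁]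
  simp only [Fintype.card_sum, Fintype.card_fin, Fintype.card_coe] at this
  omega

theorem le_card₂_of_isNonsingular_blockMatrix (hA₂ : A₂ ⊆ G.exposed₂ M)
    (hK₂ : ∀ v ∈ G.exposed₂ M, v ∉ A₂ → ∀ u, K' u v = 0)
    (h : (G.blockMatrix M (fun v a => φ (extendZero w₁ v a)) (fun v a => φ (extendZero w₂ v a))
      K' η₁ η₂).IsNonsingular) :
    r ≤ (coveredIn G.T₂ M ∪ A₂).card := by
  have hd₂ := G.covered_disjoint_of_subset_exposed₂ M hA₂
  have := h.card_columns_le (β := Fin r ⊕ (G.exposed₂ M \ A₂ : Finset V))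
    (α := coveredIn G.T₂ M ⊕ G.exposed₂ M)
    (g := Sum.elim .inl fun u => .inr (.inr (.inr (.inl ⟨u, Finset.sdiff_subset u.2⟩))))
    (f := Sum.elim (fun v => .inr (.inl v)) fun v => .inr (.inr (.inl v)))
    (Sum.inl_injective.sumElim (fun u v h => Subtype.ext
      (Subtype.mk.inj (Sum.inl.inj (Sum.inr.inj (Sum.inr.inj (Sum.inr.inj h))))))
      (fun _ _ => Sum.inl_ne_inr)) (by
      rintro (b | v | v | v | v) hv (a | u)
      all_goals first | rfl | simp at hv
      all_goals exact hK₂ _ (Finset.sdiff_subset u.2) (Finset.mem_sdiff.1 u.2).2 _)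
  have hA := Finset.card_sdiff_add_card_eq_card hA₂
  rw [Finset.card_union_of_disjoint hd₂]
  simp only [Fintype.card_sum, Fintype.card_fin, Fintype.card_coe] at this
  omega

theorem eq_zero_of_isNonsingular_blockMatrix (hA₂ : A₂ ⊆ G.exposed₂ M)
    (hδ₂ : ∀ v ∈ A₂, η₂ v = 0)
    (hK₁ : ∀ u ∈ G.exposed₁ M, u ∉ A₁ → ∀ v, K' u v = 0)
    (h : (G.blockMatrix M (fun v a => φ (extendZero w₁ v a)) (fun v a => φ (extendZero w₂ v a))
      K' η₁ η₂).IsNonsingular)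
    (s : V → R) (hs : ∀ v ∉ A₂ ∪ G.exposedColumns M, s v = 0)
    (hs0 : ∀ u ∈ A₁ ∪ G.exposedRows M, ∑ v ∈ A₂ ∪ G.exposedColumns M, K' u v * s v = 0) :
    s = 0 := by
  have hsum (u : V) : ∑ v ∈ G.exposed₂ M ∪ G.exposedColumns M, K' u v * s v =
      ∑ v ∈ A₂ ∪ G.exposedColumns M, K' u v * s v :=
    (Finset.sum_subset (Finset.union_subset_union_left hA₂) fun v _ hv => by
      rw [hs v hv, mul_zero]).symm
  have h0 := h.eq_zero_of_mulVec (y := G.columnVector M 0 0 s) fun i => by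
    rcases i with a | u | u | u | u
    · rw [blockMatrix_mul_columnVector_inl]; simp
    · rw [blockMatrix_mul_columnVector_covered]; simp
    · rw [blockMatrix_mul_columnVector_exposed₂]
      by_cases hu : (u : V) ∈ A₂
      · simp [hδ₂ u hu]
      · have : (u : V) ∉ G.exposedColumns M :=
          Finset.disjoint_left.1 (G.exposed₂_disjoint_exposedColumns M) u.2
        simp [hs u (by rw [Finset.mem_union, not_or]; exact ⟨hu, this⟩)]
    · rw [blockMatrix_mul_columnVector_exposed₁, hsum]
      by_cases hu : (u : V) ∈ A₁
      · rw [hs0 u (Finset.mem_union_left _ hu)]; simp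
      · rw [Finset.sum_eq_zero fun v _ => by rw [hK₁ u u.2 hu, zero_mul]]; simp
    · rw [blockMatrix_mul_columnVector_inr, hsum, hs0 u (Finset.mem_union_right _ u.2)]
  ext v
  by_cases hv : v ∈ A₂
  · exact congrFun h0 (.inr (.inr (.inr (.inl ⟨v, hA₂ hv⟩))))
  by_cases hv' : v ∈ G.exposedColumns M
  · exact congrFun h0 (.inr (.inr (.inr (.inr ⟨v, hv'⟩))))
  · exact hs v (by rw [Finset.mem_union, not_or]; exact ⟨hv, hv'⟩)


/-- An independent set with at least `r` elements is a basis. Squareness of the part in `X` then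
follows by counting rows and columns of the whole matrix. -/
theorem isBase_of_isNonsingular_blockMatrix (hr₁ : G.M₁.eRank = r) (hr₂ : G.M₂.eRank = r)
    (hw₁ : RepresentsMatroid (F := F) w₁ G.M₁) (hw₂ : RepresentsMatroid (F := F) w₂ G.M₂)
    (hA₁ : A₁ ⊆ G.exposed₁ M) (hA₂ : A₂ ⊆ G.exposed₂ M)
    (hδ₁ : ∀ u ∈ A₁, η₁ u = 0) (hδ₂ : ∀ v ∈ A₂, η₂ v = 0)
    (hK₁ : ∀ u ∈ G.exposed₁ M, u ∉ A₁ → ∀ v, K' u v = 0)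
    (hK₂ : ∀ v ∈ G.exposed₂ M, v ∉ A₂ → ∀ u, K' u v = 0)
    (h : (G.blockMatrix M (fun v a => φ (extendZero w₁ v a)) (fun v a => φ (extendZero w₂ v a))
      K' η₁ η₂).IsNonsingular) :
    G.M₁.IsBase ((coveredIn G.T₁ M ∪ A₁ : Finset V) : Set V) ∧
      G.M₂.IsBase ((coveredIn G.T₂ M ∪ A₂ : Finset V) : Set V) ∧
      TrivialKernelOn K' (A₁ ∪ G.exposedRows M) (A₂ ∪ G.exposedColumns M) := by
  have hI₁ := indep₁_of_isNonsingular_blockMatrix hw₁ hA₁ hδ₁ h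
  have hI₂ := indep₂_of_isNonsingular_blockMatrix hw₂ hA₂ hδ₂ h
  have hd₁ := G.covered_disjoint_of_subset_exposed₁ M hA₁
  have hd₂ := G.covered_disjoint_of_subset_exposed₂ M hA₂
  have hB₁ := hI₁.isBase_of_card hr₁ (le_card₁_of_isNonsingular_blockMatrix hA₁ hK₁ h)
  have hB₂ := hI₂.isBase_of_card hr₂ (le_card₂_of_isNonsingular_blockMatrix hA₂ hK₂ h)
  refine ⟨hB₁, hB₂, ?_,
    eq_zero_of_isNonsingular_blockMatrix hA₂ hδ₂ hK₁ h⟩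
  have hc₁ := hB₁.card_eq hr₁
  have hc₂ := hB₂.card_eq hr₂
  have hZ := (Matrix.isNonsingular_iff.1 h).1
  rw [Finset.card_union_of_disjoint hd₁] at hc₁
  rw [Finset.card_union_of_disjoint hd₂] at hc₂
  rw [Finset.card_union_of_disjoint ((G.exposed₁_disjoint_exposedRows M).mono_left hA₁),
    Finset.card_union_of_disjoint ((G.exposed₂_disjoint_exposedColumns M).mono_left hA₂)]
  rw [card_ZRow, card_ZCol] at hZ
  omega

end PathMatchingInstance

theorem TrivialKernelOn.congr {V R : Type*} [CommRing R] {K K' : V → V → R} {P Q : Finset V}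
    (h : TrivialKernelOn K P Q) (hK : ∀ i ∈ P, ∀ j ∈ Q, K i j = K' i j) :
    TrivialKernelOn K' P Q :=
  ⟨h.1, fun y hyQ hy => h.2 y hyQ fun i hi => by
    rw [← hy i hi]
    exact Finset.sum_congr rfl fun j hj => by rw [hK i hi j hj]⟩

/-! ### Expansion along `D₁` and `D₂`. -/

namespace PathMatchingInstance

variable {V : Type*} [DecidableEq V] {G : PathMatchingInstance V} {M : Set (Sym2 V)}
  {F R : Type*} [Field F] [CommRing R] {r : ℕ}

theorem blockMatrix_add (q₁ q₁' q₂ q₂' : V → Fin r → R) (K K' : V → V → R)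
    (δ₁ δ₁' δ₂ δ₂' : V → R) :
    G.blockMatrix M (q₁ + q₁') (q₂ + q₂') (K + K') (δ₁ + δ₁') (δ₂ + δ₂') =
      G.blockMatrix M q₁ q₂ K δ₁ δ₂ + G.blockMatrix M q₁' q₂' K' δ₁' δ₂' := by
  have hdiag {A : Finset V} (d d' : V → R) (u v : A) :
      Matrix.diagonal (fun w : A => (d + d') w) u v =
        Matrix.diagonal (fun w : A => d w) u v + Matrix.diagonal (fun w : A => d' w) u v := by
    by_cases h : u = v <;> simp [h]
  refine Matrix.ext fun i j => ?_
  rcases i with a | u | u | u | u <;> rcases j with b | v | v | v | v <;>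
    first
      | rfl
      | exact (add_zero 0).symm
      | exact hdiag δ₁ δ₁' u v
      | exact hdiag δ₂ δ₂' u v

theorem eq_of_blockMatrix_diagonal₁_ne_zero {δ₁ : V → R} {i : G.ZRow r M} {j : G.ZCol r M}
    (h : G.blockMatrix M 0 0 0 δ₁ 0 i j ≠ 0) :
    ∃ u : G.exposed₁ M, i = .inr (.inr (.inr (.inl u))) := by
  rcases i with a | u | u | u | u <;> rcases j with b | v | v | v | v <;>
    first
      | exact ⟨u, rfl⟩
      | exact absurd rfl h
      | exact absurd (congrFun (congrFun (Matrix.diagonal_zero (n := G.exposed₂ M)) u) v) h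

theorem eq_of_blockMatrix_diagonal₂_ne_zero {δ₂ : V → R} {i : G.ZRow r M} {j : G.ZCol r M}
    (h : G.blockMatrix M 0 0 0 0 δ₂ i j ≠ 0) :
    ∃ v : G.exposed₂ M, j = .inr (.inr (.inr (.inl v))) := by
  rcases i with a | u | u | u | u <;> rcases j with b | v | v | v | v <;>
    first
      | exact ⟨v, rfl⟩
      | exact absurd rfl h
      | exact absurd (congrFun (congrFun (Matrix.diagonal_zero (n := G.exposed₁ M)) u) v) h

open Classical in
-- Choosing the diagonal part in the rows `s₁` and the columns `s₂` yields again a block matrix: `X`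
-- is erased there, and `D₁`, `D₂` are erased at the complementary vertices `A₁`, `A₂`.
theorem blockMatrix_split_apply {q₁ q₂ : V → Fin r → R} {K : V → V → R} {δ₁ δ₂ : V → R}
    {s₁ : Finset (G.ZRow r M)} {s₂ : Finset (G.ZCol r M)}
    (hs₁ : ∀ i ∈ s₁, ∃ u : G.exposed₁ M, i = .inr (.inr (.inr (.inl u))))
    (hs₂ : ∀ j ∈ s₂, ∃ v : G.exposed₂ M, j = .inr (.inr (.inr (.inl v))))
    {A₁ A₂ : Finset V}
    (hA₁ : ∀ u : G.exposed₁ M, (u : V) ∈ A₁ ↔ .inr (.inr (.inr (.inl u))) ∉ s₁)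
    (hA₂ : ∀ v : G.exposed₂ M, (v : V) ∈ A₂ ↔ .inr (.inr (.inr (.inl v))) ∉ s₂)
    (i : G.ZRow r M) (j : G.ZCol r M) :
    G.blockMatrix M q₁ q₂
      (fun u v => if u ∈ G.exposed₁ M \ A₁ ∨ v ∈ G.exposed₂ M \ A₂ then 0 else K u v)
      (fun v => if v ∈ A₁ then 0 else δ₁ v) (fun v => if v ∈ A₂ then 0 else δ₂ v) i j =
    if j ∈ s₂ then (if i ∈ s₁ then 0 else G.blockMatrix M 0 0 0 0 δ₂ i j) else
      (if i ∈ s₁ then G.blockMatrix M 0 0 0 δ₁ 0 i j else G.blockMatrix M q₁ q₂ K 0 0 i j) := by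
  have hr1 : ∀ i : G.ZRow r M, (∀ u : G.exposed₁ M, i ≠ .inr (.inr (.inr (.inl u)))) → i ∉ s₁ :=
    fun i h hi => let ⟨u, hu⟩ := hs₁ i hi; h u hu
  have hc2 : ∀ j : G.ZCol r M, (∀ v : G.exposed₂ M, j ≠ .inr (.inr (.inr (.inl v)))) → j ∉ s₂ :=
    fun j h hj => let ⟨v, hv⟩ := hs₂ j hj; h v hv
  have hR (u : G.exposedRows M) : (u : V) ∉ G.exposed₁ M :=
    Finset.disjoint_right.1 (G.exposed₁_disjoint_exposedRows M) u.2
  have hC (v : G.exposedColumns M) : (v : V) ∉ G.exposed₂ M :=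
    Finset.disjoint_right.1 (G.exposed₂_disjoint_exposedColumns M) v.2
  have hz {i j} (h₁ : G.blockMatrix M 0 0 0 δ₁ 0 i j = 0)
      (h₂ : G.blockMatrix M 0 0 0 0 δ₂ i j = 0) (h : G.blockMatrix M q₁ q₂ K 0 0 i j = 0) :
      (if j ∈ s₂ then (if i ∈ s₁ then 0 else G.blockMatrix M 0 0 0 0 δ₂ i j) else
      (if i ∈ s₁ then G.blockMatrix M 0 0 0 δ₁ 0 i j else
        G.blockMatrix M q₁ q₂ K 0 0 i j)) = 0 := by
    rw [h, h₁, h₂]; simp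
  have hd {A B : Finset V} (δ : V → R) (u v : A) (p : Prop) [Decidable p]
      (hp : u = v → ((u : V) ∈ B ↔ ¬ p)) :
      Matrix.diagonal (fun w : A => if (w : V) ∈ B then 0 else δ w) u v =
        if p then Matrix.diagonal (fun w : A => δ w) u v else 0 := by
    by_cases huv : u = v
    · subst huv
      by_cases h : p <;> simp [hp rfl, h]
    · simp [huv]
  have hd0 {A : Finset V} (u v : A) : Matrix.diagonal (fun w : A => (0 : V → R) w) u v = 0 :=
    congrFun (congrFun Matrix.diagonal_zero u) v
  rcases i with a | u | u | u | u <;> rcases j with b | v | v | v | v <;>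
    try exact (hz rfl rfl rfl).symm
  iterate 4
    · rw [if_neg (hc2 _ (by simp)), if_neg (hr1 _ (by simp))]
      rfl
  · rw [if_neg (hr1 _ (by simp)), if_neg (hr1 _ (by simp))]
    refine (hd δ₂ u v (.inr (.inr (.inr (.inl v))) ∈ s₂) fun huv => huv ▸ hA₂ v).trans ?_
    exact congrArg _ (hd0 u v).symm
  · rw [if_neg (hc2 _ (by simp))]
    refine (hd δ₁ u v (.inr (.inr (.inr (.inl u))) ∈ s₁) fun _ => hA₁ u).trans ?_
    exact congrArg _ (hd0 u v).symm
  · have h₁ : (u : V) ∈ G.exposed₁ M \ A₁ ↔ .inr (.inr (.inr (.inl u))) ∈ s₁ := by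
      simp [hA₁ u]
    have h₂ : (v : V) ∈ G.exposed₂ M \ A₂ ↔ .inr (.inr (.inr (.inl v))) ∈ s₂ := by
      simp [hA₂ v]
    change (if (u : V) ∈ G.exposed₁ M \ A₁ ∨ (v : V) ∈ G.exposed₂ M \ A₂ then 0 else K u v) =
      if _ then (if _ then 0 else 0) else (if _ then 0 else K u v)
    by_cases hu : Sum.inr (Sum.inr (Sum.inr (Sum.inl u))) ∈ s₁ <;>
      by_cases hv : Sum.inr (Sum.inr (Sum.inr (Sum.inl v))) ∈ s₂ <;>
        simp only [h₁, h₂, hu, hv, or_self, or_true, true_or, if_true, if_false]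
  · have h₁ : (u : V) ∈ G.exposed₁ M \ A₁ ↔ .inr (.inr (.inr (.inl u))) ∈ s₁ := by
      simp [hA₁ u]
    rw [if_neg (hc2 _ (by simp))]
    change (if (u : V) ∈ G.exposed₁ M \ A₁ ∨ (v : V) ∈ G.exposed₂ M \ A₂ then 0 else K u v) =
      (if _ then 0 else K u v)
    simp only [h₁, Finset.mem_sdiff, hC v, false_and, or_false]
  · have h₂ : (v : V) ∈ G.exposed₂ M \ A₂ ↔ .inr (.inr (.inr (.inl v))) ∈ s₂ := by
      simp [hA₂ v]
    rw [if_neg (hr1 _ (by simp)), if_neg (hr1 _ (by simp))]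
    change (if (u : V) ∈ G.exposed₁ M \ A₁ ∨ (v : V) ∈ G.exposed₂ M \ A₂ then 0 else K u v) =
      (if _ then 0 else K u v)
    simp only [h₂, Finset.mem_sdiff, hR u, false_and, false_or]
  · rw [if_neg (hc2 _ (by simp)), if_neg (hr1 _ (by simp))]
    refine if_neg ?_
    simp only [Finset.mem_sdiff, hR u, hC v, false_and, or_self, not_false_eq_true]

open Classical in
/-- Expanding the determinant along the rows that meet `D₁` and the columns that meet `D₂`. -/
theorem exists_split_of_isNonsingular_blockMatrix {q₁ q₂ : V → Fin r → R} {K : V → V → R}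
    {δ₁ δ₂ : V → R} (h : (G.blockMatrix M q₁ q₂ K δ₁ δ₂).IsNonsingular) :
    ∃ A₁ ⊆ G.exposed₁ M, ∃ A₂ ⊆ G.exposed₂ M,
      (G.blockMatrix M q₁ q₂
        (fun u v => if u ∈ G.exposed₁ M \ A₁ ∨ v ∈ G.exposed₂ M \ A₂ then 0 else K u v)
        (fun v => if v ∈ A₁ then 0 else δ₁ v)
        (fun v => if v ∈ A₂ then 0 else δ₂ v)).IsNonsingular := by
  have hadd₁ := blockMatrix_add (G := G) (M := M) q₁ 0 q₂ 0 K 0 0 δ₁ δ₂ 0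
  have hadd := blockMatrix_add (G := G) (M := M) q₁ 0 q₂ 0 K 0 0 0 0 δ₂
  simp only [add_zero, zero_add] at hadd₁ hadd
  rw [hadd₁] at h
  obtain ⟨s₁, hs₁, h⟩ := h.exists_rows
  -- Rows already taken from `D₁` carry no entry of `D₂`; in the other rows `D₂` is split off as a
  -- summand, to be expanded by columns.
  have hadd₂ : (Matrix.of fun i j => if i ∈ s₁ then G.blockMatrix M 0 0 0 δ₁ 0 i j else
        G.blockMatrix M q₁ q₂ K 0 δ₂ i j) =
      (Matrix.of fun i j => if i ∈ s₁ then G.blockMatrix M 0 0 0 δ₁ 0 i j else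
        G.blockMatrix M q₁ q₂ K 0 0 i j) +
      (Matrix.of fun i j => if i ∈ s₁ then 0 else G.blockMatrix M 0 0 0 0 δ₂ i j) := by
    refine Matrix.ext fun i j => ?_
    by_cases hi : i ∈ s₁ <;> simp [hi, hadd]
  rw [hadd₂] at h
  obtain ⟨s₂, hs₂, h⟩ := h.exists_columns
  refine ⟨(G.exposed₁ M).filter fun u => ∃ h, .inr (.inr (.inr (.inl ⟨u, h⟩))) ∉ s₁,
    Finset.filter_subset _ _,
    (G.exposed₂ M).filter fun v => ∃ h, .inr (.inr (.inr (.inl ⟨v, h⟩))) ∉ s₂,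
    Finset.filter_subset _ _, ?_⟩
  convert h using 1
  refine Matrix.ext fun i j => ?_
  exact blockMatrix_split_apply (fun i hi => let ⟨_, hj⟩ := hs₁ i hi
      eq_of_blockMatrix_diagonal₁_ne_zero hj)
    (fun j hj => let ⟨i, hi⟩ := hs₂ j hj
      eq_of_blockMatrix_diagonal₂_ne_zero (i := i) (δ₂ := δ₂) fun h0 => hi (by simp [h0]))
    (by simp) (by simp) i j

end PathMatchingInstance

/-! ### Path-matchings versus kernels and linkages. -/

theorem SimpleGraph.Walk.exists_mem_edges_of_mem_support {V : Type*} {H : SimpleGraph V} {a b : V}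
    (p : H.Walk a b) (hab : a ≠ b) {v : V} (hv : v ∈ p.support) : ∃ e ∈ p.edges, v ∈ e := by
  have hn : ¬ p.Nil := fun h => hab h.eq
  obtain ⟨e, he, hve⟩ := (SimpleGraph.Walk.mem_support_iff_exists_mem_edges_of_not_nil hn).1 hv
  exact ⟨e, he, hve⟩

section Kernel

variable {V R : Type*} [CommRing R] [IsDomain R] {H : SimpleGraph V} {K : V → V → R}
  {N : Set (Sym2 V)} {Q : Finset V} {y : V → R}

/-- A kernel vector that vanishes at the start of a path component vanishes along the path. -/
theorem eq_zero_of_mem_support_of_kernel (hK : ∀ i j, K i j ≠ 0 ↔ s(i, j) ∈ N)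
    (hQ : ∀ j ∉ Q, y j = 0) {a b : V} (p : H.Walk a b) (hp : p.IsPath)
    (hrow : ∀ w ∈ p.support, w ≠ b → ∑ j ∈ Q, K w j * y j = 0) (hedges : ∀ e ∈ p.edges, e ∈ N)
    (hloc : ∀ w ∈ p.support, ∀ j, s(w, j) ∈ N → s(w, j) ∈ p.edges ∨ y j = 0) (ha : y a = 0) :
    ∀ w ∈ p.support, y w = 0 := by
  induction p with
  | nil => intro w hw; rw [SimpleGraph.Walk.mem_support_nil_iff] at hw; rwa [hw]
  | @cons u v b h q ih =>
    rw [SimpleGraph.Walk.cons_isPath_iff] at hp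
    have hub : u ≠ b := fun hub => hp.2 (hub ▸ q.end_mem_support)
    -- Every neighbour of `u` in `N` other than `v` carries the value 0, so the equation of row `u`
    -- reads `K u v * y v = 0`.
    have hv : y v = 0 := by
      by_cases hvQ : v ∈ Q
      · have h0 := hrow u (by simp) hub
        rw [Finset.sum_eq_single_of_mem v hvQ fun j _ hjv => ?_] at h0
        · exact (mul_eq_zero.1 h0).resolve_left ((hK u v).2 (hedges _ (by simp)))
        · by_contra hne
          rcases hloc u (by simp) j ((hK u j).1 (left_ne_zero_of_mul hne)) with he | he
          · rw [SimpleGraph.Walk.edges_cons, List.mem_cons] at he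
            rcases he with he | he
            · exact hjv (Sym2.congr_right.1 he)
            · exact hp.2 (q.fst_mem_support_of_mem_edges he)
          · exact right_ne_zero_of_mul hne he
      · exact hQ v hvQ
    have hq := ih hp.1 (fun w hw => hrow w (by simp [hw])) (fun e he => hedges e (by simp [he]))
      (fun w hw j hj => ?_) hv
    · intro w hw
      rw [SimpleGraph.Walk.support_cons, List.mem_cons] at hw
      rcases hw with rfl | hw
      · exact ha
      · exact hq w hw
    -- The edge from `v` back to `u` is not on `q`; this is why `hloc` also admits neighbours at
    -- which `y` vanishes.
    · rcases hloc w (by simp [hw]) j hj with he | he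
      · rw [SimpleGraph.Walk.edges_cons, List.mem_cons] at he
        refine he.imp_left (fun he => ?_) |>.symm.elim .inl fun h => .inr h
        rcases Sym2.eq_iff.1 he with ⟨rfl, rfl⟩ | ⟨rfl, rfl⟩
        · exact absurd hw hp.2
        · exact ha
      · exact .inr he

end Kernel

namespace PathMatchingInstance

variable {V : Type*} [DecidableEq V] {G : PathMatchingInstance V} {N : Set (Sym2 V)}

/-- Starts and ends are equal in number. A start lies in `T₁` and indexes no column, so a kernel
vector vanishes there, hence along the whole path. At a vertex covered by the matching, the row of
its partner forces the value 0. -/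
theorem IsPathMatching.trivialKernelOn {R : Type*} [CommRing R] [IsDomain R] {K : V → V → R}
    (hN : G.IsPathMatching N) (hS : coveredIn G.S N = G.S)
    (hK : ∀ i j, K i j ≠ 0 ↔ s(i, j) ∈ N) :
    TrivialKernelOn K (coveredIn G.T₁ N ∪ G.S) (coveredIn G.T₂ N ∪ G.S) := by
  obtain ⟨k, a, b, p, N₀, hp, hdisj, -, hN₀, hmatch, rfl⟩ := hN
  have hab (i) : a i ≠ b i := fun h =>
    Finset.disjoint_left.1 G.disj_T₁_T₂ (hp i).2.1 (h ▸ (hp i).2.2.1)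
  have hTS₁ {v} (h : v ∈ G.T₁) : v ∉ G.S := Finset.disjoint_left.1 G.disj_T₁_S h
  have hTS₂ {v} (h : v ∈ G.T₂) : v ∉ G.S := Finset.disjoint_left.1 G.disj_T₂_S h
  have hT {v} (h : v ∈ G.T₁) : v ∉ G.T₂ := Finset.disjoint_left.1 G.disj_T₁_T₂ h
  have hcov {i v} (hv : v ∈ (p i).support) :
      ∃ e ∈ {e | ∃ i, e ∈ (p i).edges} ∪ N₀, v ∈ e := by
    obtain ⟨e, he, hve⟩ := (p i).exists_mem_edges_of_mem_support (hab i) hv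
    exact ⟨e, .inl ⟨i, he⟩, hve⟩
  have hcov' {v} (h : ∃ e ∈ {e | ∃ i, e ∈ (p i).edges} ∪ N₀, v ∈ e) (hv : v ∉ G.S) :
      ∃ i, v = a i ∨ v = b i := by
    obtain ⟨e, ⟨i, he⟩ | he, hve⟩ := h
    · refine ⟨i, ?_⟩
      by_contra! h
      exact hv ((hp i).2.2.2 v (SimpleGraph.Walk.mem_support_of_mem_edges he hve) h.1 h.2)
    · exact absurd (hN₀ e he v hve).1 hv
  have hinj {i j v} (hi : v ∈ (p i).support) (hj : v ∈ (p j).support) : i = j := by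
    by_contra hij
    exact hdisj i j hij v hi hj
  have hc₁ : coveredIn G.T₁ ({e | ∃ i, e ∈ (p i).edges} ∪ N₀) = Finset.univ.image a := by
    ext v
    rw [mem_coveredIn, Finset.mem_image]
    constructor
    · rintro ⟨hv, h⟩
      obtain ⟨i, rfl | rfl⟩ := hcov' h (hTS₁ hv)
      · exact ⟨i, Finset.mem_univ _, rfl⟩
      · exact absurd (hp i).2.2.1 (hT hv)
    · rintro ⟨i, -, rfl⟩
      exact ⟨(hp i).2.1, hcov (p i).start_mem_support⟩
  have hc₂ : coveredIn G.T₂ ({e | ∃ i, e ∈ (p i).edges} ∪ N₀) = Finset.univ.image b := by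
    ext v
    rw [mem_coveredIn, Finset.mem_image]
    constructor
    · rintro ⟨hv, h⟩
      obtain ⟨i, rfl | rfl⟩ := hcov' h (hTS₂ hv)
      · exact absurd hv (hT (hp i).2.1)
      · exact ⟨i, Finset.mem_univ _, rfl⟩
    · rintro ⟨i, -, rfl⟩
      exact ⟨(hp i).2.2.1, hcov (p i).end_mem_support⟩
  rw [hc₁, hc₂]
  constructor
  · rw [Finset.card_union_of_disjoint, Finset.card_union_of_disjoint,
      Finset.card_image_of_injective, Finset.card_image_of_injective]
    · exact fun i j h => hinj (p i).end_mem_support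
        (by rw [show b i = b j from h]; exact (p j).end_mem_support)
    · exact fun i j h => hinj (p i).start_mem_support
        (by rw [show a i = a j from h]; exact (p j).start_mem_support)
    · rw [← hc₂]; exact G.disj_T₂_S.mono_left (coveredIn_subset _ _)
    · rw [← hc₁]; exact G.disj_T₁_S.mono_left (coveredIn_subset _ _)
  intro y hyQ hy
  have hpath (i) : ∀ w ∈ (p i).support, y w = 0 := by
    refine eq_zero_of_mem_support_of_kernel hK hyQ (p i) (hp i).1 (fun w hw hwb => hy w ?_)
      (fun e he => .inl ⟨i, he⟩) (fun w hw j hj => .inl ?_) (hyQ _ ?_)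
    · by_cases hwa : w = a i
      · exact Finset.mem_union_left _ (Finset.mem_image.2 ⟨i, Finset.mem_univ _, hwa.symm⟩)
      · exact Finset.mem_union_right _ ((hp i).2.2.2 w hw hwa hwb)
    · rcases hj with ⟨i', hj⟩ | hj
      · rwa [hinj hw ((p i').fst_mem_support_of_mem_edges hj)]
      · exact absurd hw ((hN₀ _ hj w (Sym2.mem_mk_left _ _)).2 i)
    · rw [← hc₂, Finset.mem_union, not_or]
      exact ⟨fun h => hT (hp i).2.1 (coveredIn_subset _ _ h), hTS₁ (hp i).2.1⟩
  ext v
  by_cases hvQ : v ∈ Finset.univ.image b ∪ G.S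
  · rcases Finset.mem_union.1 hvQ with hv | hv
    · obtain ⟨i, -, rfl⟩ := Finset.mem_image.1 hv
      exact hpath i _ (p i).end_mem_support
    · obtain ⟨-, e, ⟨i, he⟩ | he, hve⟩ := mem_coveredIn.1 (hS.symm ▸ hv)
      · exact hpath i v (SimpleGraph.Walk.mem_support_of_mem_edges he hve)
      · obtain ⟨w, rfl⟩ := Sym2.mem_iff_exists.1 hve
        have hw := hN₀ _ he w (Sym2.mem_mk_right _ _)
        -- The only edge at the partner `w` is `{v, w}`, so this equation has a single term.
        have h0 := hy w (Finset.mem_union_right _ hw.1)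
        rw [Finset.sum_eq_single_of_mem v hvQ fun j _ hjv => ?_] at h0
        · exact (mul_eq_zero.1 h0).resolve_left ((hK w v).2 (by rw [Sym2.eq_swap]; exact .inr he))
        · rw [mul_eq_zero]
          left
          by_contra hne
          rcases (hK w j).1 hne with ⟨i, hj⟩ | hj
          · exact hw.2 i ((p i).fst_mem_support_of_mem_edges hj)
          · have := hmatch _ hj _ he w (Sym2.mem_mk_left _ _) (Sym2.mem_mk_right _ _)
            rw [Sym2.eq_swap] at this
            exact hjv (Sym2.congr_left.1 this)
  · exact hyQ v hvQ

theorem exists_isPathMatching_of_isLinkage {A : List V} {B : Finset V}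
    {L : List (Σ a b : V, G.graph.Walk a b)} (h : IsLinkage G.graph A B G.S L N)
    (hA : A.toFinset ⊆ G.T₁) (hB : B ⊆ G.T₂) :
    ∃ N', G.IsPathMatching N' ∧ coveredIn G.T₁ N' = A.toFinset ∧ coveredIn G.T₂ N' = B ∧
      coveredIn G.S N' = G.S := by
  have hstart {x} (hx : x ∈ L) : x.1 ∈ A := by
    rw [← h.starts]; exact List.mem_map_of_mem hx
  have hT₁ {x} (hx : x ∈ L) : x.1 ∈ G.T₁ := hA (by simpa using hstart hx)
  have hT₂ {x} (hx : x ∈ L) : x.2.1 ∈ G.T₂ := hB (h.ends x hx)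
  have hT {v} (h : v ∈ G.T₁) : v ∉ G.T₂ := Finset.disjoint_left.1 G.disj_T₁_T₂ h
  have hTS₁ {v} (h : v ∈ G.T₁) : v ∉ G.S := Finset.disjoint_left.1 G.disj_T₁_S h
  have hTS₂ {v} (h : v ∈ G.T₂) : v ∉ G.S := Finset.disjoint_left.1 G.disj_T₂_S h
  have hne {x} (hx : x ∈ L) : x.1 ≠ x.2.1 := fun heq => hT (hT₁ hx) (heq ▸ hT₂ hx)
  have hnodup := List.nodup_flatMap.1 h.nodup
  let N' : Set (Sym2 V) := {e | ∃ i : Fin L.length, e ∈ (L.get i).2.2.edges} ∪ N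
  have hcov {x} (hx : x ∈ L) {v} (hv : v ∈ x.2.2.support) : ∃ e ∈ N', v ∈ e := by
    obtain ⟨e, he, hve⟩ := x.2.2.exists_mem_edges_of_mem_support (hne hx) hv
    obtain ⟨i, rfl⟩ := List.get_of_mem hx
    exact ⟨e, .inl ⟨i, he⟩, hve⟩
  have hcov' {v} (hv : ∃ e ∈ N', v ∈ e) : v ∈ A ∨ v ∈ B ∨ v ∈ G.S := by
    obtain ⟨e, ⟨i, he⟩ | he, hve⟩ := hv
    · exact h.mem_of_mem_support (L.get_mem i)
        (SimpleGraph.Walk.mem_support_of_mem_edges he hve)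
    · exact .inr (.inr (h.matching_mem e he v hve).1)
  refine ⟨N', ⟨L.length, fun i => (L.get i).1, fun i => (L.get i).2.1, fun i => (L.get i).2.2, N,
    ?_, ?_, h.subset, ?_, h.matching, rfl⟩, ?_, ?_, ?_⟩
  · intro i
    have hi := L.get_mem i
    exact ⟨SimpleGraph.Walk.IsPath.mk' (hnodup.1 _ hi), hT₁ hi, hT₂ hi,
      h.inner _ hi⟩
  · intro i j hij v hi hj
    have hd := List.pairwise_iff_get.1 hnodup.2
    rcases lt_or_gt_of_ne hij with hij | hij
    · exact hd i j hij hi hj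
    · exact hd j i hij hj hi
  · exact fun e he v hv => ⟨(h.matching_mem e he v hv).1,
      fun i => (h.matching_mem e he v hv).2 _ (L.get_mem i)⟩
  · ext v
    rw [mem_coveredIn, List.mem_toFinset]
    constructor
    · rintro ⟨hv, hc⟩
      rcases hcov' hc with h' | h' | h'
      · exact h'
      · exact absurd (hB h') (hT hv)
      · exact absurd h' (hTS₁ hv)
    · intro hv
      refine ⟨hA (by simpa using hv), ?_⟩
      rw [← h.starts] at hv
      obtain ⟨x, hx, rfl⟩ := List.mem_map.1 hv
      exact hcov hx x.2.2.start_mem_support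
  · ext v
    rw [mem_coveredIn]
    constructor
    · rintro ⟨hv, hc⟩
      rcases hcov' hc with h' | h' | h'
      · exact absurd hv (hT (hA (by simpa using h')))
      · exact h'
      · exact absurd h' (hTS₂ hv)
    · intro hv
      obtain ⟨x, hx, rfl⟩ := h.covers_ends v hv
      exact ⟨hB hv, hcov hx x.2.2.end_mem_support⟩
  · ext v
    rw [mem_coveredIn]
    refine ⟨fun h => h.1, fun hv => ⟨hv, ?_⟩⟩
    rcases h.covers v hv with ⟨x, hx, hvx⟩ | ⟨e, he, hve⟩
    · exact hcov hx hvx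
    · exact ⟨e, .inr he, hve⟩

end PathMatchingInstance

/-! ### The contraction `G(M)` and the two directions of the theorem. -/

namespace PathMatchingInstance

variable {V : Type*} [DecidableEq V] {F : Type*} [Field F] (G : PathMatchingInstance V)
  (M : Set (Sym2 V))

theorem contract_isBase₁_iff (hM₁ : G.M₁.Indep (coveredIn G.T₁ M : Set V)) {A : Finset V}
    (hA : A ⊆ G.exposed₁ M) :
    (G.contract M).M₁.IsBase ((A ∪ G.C₁ M : Finset V) : Set V) ↔
      G.M₁.IsBase ((coveredIn G.T₁ M ∪ A : Finset V) : Set V) :=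
  Matroid.disjointSum_contract_freeOn_isBase_iff hM₁ (G.disjoint_ground₁ M) <| by
    rw [G.ground₁, ← Finset.coe_sdiff]
    exact_mod_cast hA

theorem contract_isBase₂_iff (hM₂ : G.M₂.Indep (coveredIn G.T₂ M : Set V)) {A : Finset V}
    (hA : A ⊆ G.exposed₂ M) :
    (G.contract M).M₂.IsBase ((A ∪ G.C₂ M : Finset V) : Set V) ↔
      G.M₂.IsBase ((coveredIn G.T₂ M ∪ A : Finset V) : Set V) :=
  Matroid.disjointSum_contract_freeOn_isBase_iff hM₂ (G.disjoint_ground₂ M) <| by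
    rw [G.ground₂, ← Finset.coe_sdiff]
    exact_mod_cast hA

theorem C₁_subset_of_contract_isBase {B : Finset V}
    (h : (G.contract M).M₁.IsBase (B : Set V)) : G.C₁ M ⊆ B := by
  have := (Matroid.disjointSum_isBase_iff.1 h).2.1
  rw [Matroid.freeOn_isBase_iff, Matroid.freeOn_ground] at this
  exact_mod_cast Set.inter_eq_right.1 this

theorem C₂_subset_of_contract_isBase {B : Finset V}
    (h : (G.contract M).M₂.IsBase (B : Set V)) : G.C₂ M ⊆ B := by
  have := (Matroid.disjointSum_isBase_iff.1 h).2.1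
  rw [Matroid.freeOn_isBase_iff, Matroid.freeOn_ground] at this
  exact_mod_cast Set.inter_eq_right.1 this

theorem contract_adj_of_mem {u v : V} (hu : u ∈ G.T₁' M ∪ G.exposedS M)
    (hv : v ∈ G.T₂' M ∪ G.exposedS M) (h : G.graph.Adj u v) : (G.contract M).graph.Adj u v := by
  refine ⟨h, ?_⟩
  simp only [Finset.mem_union] at hu hv ⊢
  tauto

theorem exists_isBasicPathMatching_contract {R : Type*} [CommRing R] [IsDomain R]
    (hM₁ : G.M₁.Indep (coveredIn G.T₁ M : Set V)) (hM₂ : G.M₂.Indep (coveredIn G.T₂ M : Set V))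
    {A₁ A₂ : Finset V} (hA₁ : A₁ ⊆ G.exposed₁ M) (hA₂ : A₂ ⊆ G.exposed₂ M)
    (hB₁ : G.M₁.IsBase ((coveredIn G.T₁ M ∪ A₁ : Finset V) : Set V))
    (hB₂ : G.M₂.IsBase ((coveredIn G.T₂ M ∪ A₂ : Finset V) : Set V)) {K : V → V → R}
    (hadj : ∀ i j, K i j ≠ 0 → G.graph.Adj i j)
    (hskew : ∀ i ∈ G.S, ∀ j ∈ G.S, K j i = - K i j)
    (hK : TrivialKernelOn K (A₁ ∪ G.exposedRows M) (A₂ ∪ G.exposedColumns M)) :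
    ∃ N, (G.contract M).IsBasicPathMatching N := by
  have hA₁' : A₁ ∪ G.C₁ M ⊆ G.T₁' M := Finset.union_subset_union_left hA₁
  have hA₂' : A₂ ∪ G.C₂ M ⊆ G.T₂' M := Finset.union_subset_union_left hA₂
  have hS : G.exposedS M ⊆ G.S := Finset.sdiff_subset
  -- Regrouped so that `C₁` joins the starts and `C₂` the ends; only `S'` indexes both rows and
  -- columns, and only there is skew-symmetry needed.
  rw [← Finset.union_assoc, ← Finset.union_assoc] at hK
  obtain ⟨L, N, hL⟩ := TrivialKernelOn.exists_isLinkage (H := (G.contract M).graph) (K := K)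
    (A := (A₁ ∪ G.C₁ M).toList) (B := A₂ ∪ G.C₂ M) (S := G.exposedS M) (Finset.nodup_toList _)
    (by rw [Finset.toList_toFinset]; exact (G.disjoint_T₁'_T₂' M).mono hA₁' hA₂')
    (by rw [Finset.toList_toFinset]; exact (G.disjoint_T₁'_exposedS M).mono_left hA₁')
    ((G.disjoint_T₂'_exposedS M).mono_left hA₂')
    (fun i hi j hj hij => by
      rw [Finset.toList_toFinset] at hi
      exact G.contract_adj_of_mem M (Finset.union_subset_union_left hA₁' hi)
        (Finset.union_subset_union_left hA₂' hj) (hadj i j hij))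
    (fun i hi j hj => hskew i (hS hi) j (hS hj))
    (fun i => by by_contra h; exact G.graph.irrefl (hadj i i h))
    (by rwa [Finset.toList_toFinset])
  obtain ⟨N', hN', h₁, h₂, h₃⟩ := exists_isPathMatching_of_isLinkage (G := G.contract M) hL
    (by rw [Finset.toList_toFinset]; exact hA₁') hA₂'
  rw [Finset.toList_toFinset] at h₁
  refine ⟨N', hN', ?_, ?_, h₃⟩
  · rw [h₁]; exact (G.contract_isBase₁_iff M hM₁ hA₁).2 hB₁
  · rw [h₂]; exact (G.contract_isBase₂_iff M hM₂ hA₂).2 hB₂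

theorem IsPathMatching.subset {N : Set (Sym2 V)} (h : G.IsPathMatching N) :
    N ⊆ G.graph.edgeSet := by
  obtain ⟨k, a, b, p, N₀, -, -, hN₀, -, -, rfl⟩ := h
  rintro e (⟨i, he⟩ | he)
  · exact (p i).edges_subset_edgeSet he
  · exact hN₀ he

theorem adj_of_edgeMatrix_ne_zero {ε : V → V → ℤˣ} {i j : V} (h : G.edgeMatrix F ε i j ≠ 0) :
    G.graph.Adj i j := by
  by_contra hadj
  exact h (by simp [edgeMatrix, hadj])

theorem isNonsingular_Z_of_isBasicPathMatching {r : ℕ}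
    (hr₁ : G.M₁.eRank = r) (hr₂ : G.M₂.eRank = r)
    (Q₁ : Matrix (Fin r) G.T₁ F) (Q₂ : Matrix G.T₂ (Fin r) F)
    (hQ₁ : RepresentsMatroid (F := F) Q₁.col G.M₁) (hQ₂ : RepresentsMatroid (F := F) Q₂.row G.M₂)
    (ε : V → V → ℤˣ)
    (hM₁ : G.M₁.Indep (coveredIn G.T₁ M : Set V)) (hM₂ : G.M₂.Indep (coveredIn G.T₂ M : Set V))
    {N : Set (Sym2 V)} (hN : (G.contract M).IsBasicPathMatching N) :
    (G.Z Q₁ Q₂ ε M).IsNonsingular := by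
  classical
  obtain ⟨hN, hB₁, hB₂, hS⟩ := hN
  set P₁ := coveredIn (G.contract M).T₁ N with hP₁
  set P₂ := coveredIn (G.contract M).T₂ N with hP₂
  have hC₁ := G.C₁_subset_of_contract_isBase M hB₁
  have hC₂ := G.C₂_subset_of_contract_isBase M hB₂
  have hsplit₁ : P₁ ∩ G.exposed₁ M ∪ G.C₁ M = P₁ := by
    have h : P₁ ⊆ G.exposed₁ M ∪ G.C₁ M := coveredIn_subset _ _
    ext v
    have := @h v
    have := @hC₁ v
    simp only [Finset.mem_union, Finset.mem_inter] at *
    tauto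
  have hsplit₂ : P₂ ∩ G.exposed₂ M ∪ G.C₂ M = P₂ := by
    have h : P₂ ⊆ G.exposed₂ M ∪ G.C₂ M := coveredIn_subset _ _
    ext v
    have := @h v
    have := @hC₂ v
    simp only [Finset.mem_union, Finset.mem_inter] at *
    tauto
  -- This evaluation selects the contribution of `N`: `X` becomes a signed indicator of `N`, and a
  -- diagonal entry survives exactly at the vertices that `N` leaves uncovered. The choice is thus
  -- `Aᵢ = Pᵢ ∩ exposedᵢ`.
  let f : Indet V → F
    | .x e => if e ∈ N then 1 else 0
    | .d₁ v => if v ∈ P₁ then 0 else 1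
    | .d₂ v => if v ∈ P₂ then 0 else 1
  let φ : MvPolynomial (Indet V) F →+* F := MvPolynomial.eval f
  have hKN (i j : V) : φ (G.edgeMatrix F ε i j) ≠ 0 ↔ s(i, j) ∈ N := by
    by_cases hadj : G.graph.Adj i j
    · have hε : ((ε i j : ℤ) : F) ≠ 0 := by
        rcases Int.units_eq_one_or (ε i j) with h | h <;> simp [h]
      simp [edgeMatrix, hadj, φ, f, hε]
    · have : s(i, j) ∉ N := fun h => hadj ((hN.subset (G := G.contract M) h).1)
      simp [edgeMatrix, hadj, this]
  have hX := hN.trivialKernelOn hS hKN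
  rw [← hP₁, ← hP₂, ← hsplit₁, ← hsplit₂, Finset.union_assoc, Finset.union_assoc] at hX
  rw [← hsplit₁, G.contract_isBase₁_iff M hM₁ Finset.inter_subset_right] at hB₁
  rw [← hsplit₂, G.contract_isBase₂_iff M hM₂ Finset.inter_subset_right] at hB₂
  refine Matrix.IsNonsingular.of_map φ ?_
  rw [Z_eq_blockMatrix, blockMatrix_map]
  have := isNonsingular_blockMatrix (δ₁ := fun v => φ (MvPolynomial.X (Indet.d₁ v)))
    (δ₂ := fun v => φ (MvPolynomial.X (Indet.d₂ v))) hr₁ hr₂ hQ₁ hQ₂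
    Finset.inter_subset_right Finset.inter_subset_right hB₁ hB₂
    (fun u hu hu' => by simpa [φ, f, hu] using hu')
    (fun u hu => by simpa [φ, f] using (Finset.mem_inter.1 hu).1)
    (fun u hu hu' => by simpa [φ, f, hu] using hu')
    (fun u hu => by simpa [φ, f] using (Finset.mem_inter.1 hu).1)
    (fun u hu hu' v => by
      by_contra hne
      refine hu' (Finset.mem_inter.2 ⟨mem_coveredIn.2 ⟨Finset.mem_union_left _ hu, _,
        (hKN u v).1 hne, Sym2.mem_mk_left _ _⟩, hu⟩)) hX
  simpa [φ] using this

end PathMatchingInstance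

theorem mainTheorem1 {V F : Type*} [DecidableEq V] [Field F] (G : PathMatchingInstance V)
    (t r : ℕ) (ht₁ : G.T₁.card = t) (ht₂ : G.T₂.card = t)
    (hr₁ : G.M₁.eRank = r) (hr₂ : G.M₂.eRank = r)
    (Q₁ : Matrix (Fin r) G.T₁ F) (Q₂ : Matrix G.T₂ (Fin r) F)
    (hQ₁ : RepresentsMatroid (F := F) Q₁.col G.M₁) (hQ₂ : RepresentsMatroid (F := F) Q₂.row G.M₂)
    (ε : V → V → ℤˣ)
    (hε : ∀ i ∈ G.S, ∀ j ∈ G.S, G.edgeMatrix F ε j i = - G.edgeMatrix F ε i j)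
    (M : Set (Sym2 V)) (hM : M ⊆ G.graph.edgeSet)
    (hM₁ : G.M₁.Indep (coveredIn G.T₁ M : Set V)) (hM₂ : G.M₂.Indep (coveredIn G.T₂ M : Set V)) :
    (∃ N : Set (Sym2 V), (G.contract M).IsBasicPathMatching N) ↔ (G.Z Q₁ Q₂ ε M).IsNonsingular := by
  constructor
  · rintro ⟨N, hN⟩
    exact G.isNonsingular_Z_of_isBasicPathMatching M hr₁ hr₂ Q₁ Q₂ hQ₁ hQ₂ ε hM₁ hM₂ hN
  · intro h
    rw [PathMatchingInstance.Z_eq_blockMatrix] at h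
    obtain ⟨A₁, hA₁, A₂, hA₂, h⟩ :=
      PathMatchingInstance.exists_split_of_isNonsingular_blockMatrix h
    obtain ⟨hB₁, hB₂, hK⟩ := PathMatchingInstance.isBase_of_isNonsingular_blockMatrix hr₁ hr₂ hQ₁ hQ₂
      hA₁ hA₂
      (fun u hu => if_pos hu) (fun v hv => if_pos hv)
      (fun u hu hu' v => if_pos (.inl (Finset.mem_sdiff.2 ⟨hu, hu'⟩)))
      (fun v hv hv' u => if_pos (.inr (Finset.mem_sdiff.2 ⟨hv, hv'⟩))) h
    -- The erased entries lie outside the rows and columns of this minor, so the minor is one of `X`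
    -- itself, where skew-symmetry on `S` is available.
    have hK' := hK.congr (K' := G.edgeMatrix F ε) fun i hi j hj => if_neg <| by
      have h₁ := @Finset.disjoint_left.1 (G.exposed₁_disjoint_exposedRows M) i
      have h₂ := @Finset.disjoint_left.1 (G.exposed₂_disjoint_exposedColumns M) j
      simp only [Finset.mem_union, Finset.mem_sdiff] at *
      tauto
    exact G.exists_isBasicPathMatching_contract M hM₁ hM₂ hA₁ hA₂ hB₁ hB₂
      (fun i j hij => G.adj_of_edgeMatrix_ne_zero hij) hε hK'
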